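/- \textbf{Model (abstract Tile Assembly Model).} A \emph{tile system} $\Gamma=(T,\sigma,\tau)$ consists of a finite set $T$ of tile types (labelled unit squares, each side carrying a glue; every glue $g$ has a strength $\mathrm{str}(g)\in\mathbb{Z}_{\ge 0}$; tiles are not rotated), a temperature $\tau\in\mathbb{Z}_{>0}$, and a seed $\sigma$, a finite nonempty $\tau$-stable assembly. An \emph{assembly} places finitely many translated copies of tiles of $T$ on distinct cells of $\mathbb{Z}^2$. It is \emph{$\tau$-stable} if every cut of its bond graph has weight at least $\tau$, where two adjacent tiles are joined by an edge of weight $\mathrm{str}(g)$ if both carry the glue $g$ on their common side. The \emph{producible} assemblies are those obtained from $\sigma$ by successively adding single tiles on empty cells, every assembly on the way being $\tau$-stable; the \emph{frontier} of a producible assembly is the set of placed tiles that can be added in the next step; the set $\mathrm{TERM}_\Gamma$ of \emph{terminal} assemblies consists of the producible assemblies with empty frontier. A \emph{concentration distribution} on $T$ is a function $P:T\to(0,\infty)$ with $\sum_{t\in T}P(t)=1$. It makes the growth from $\sigma$ a Markov chain in which each tile in the frontier of the current assembly is added with probability equal to the concentration of its type divided by the sum of the concentrations of the types of all tiles in the frontier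 (counted with multiplicity). For $A\in\mathrm{TERM}_\Gamma$ let $\Pr^P[\Gamma\to A]$ be the probability that this chain ends in $A$. $\Gamma$ is a \emph{unidirectional two-choice linear assembly system} if for every producible assembly (i) all tiles in its frontier lie at one location (or the frontier is empty), (ii) its frontier has at most two elements, and (iii) it is a $1\times n$ line, i.e. its occupied cells are $n$ consecutive cells of one row, for some $n$. For an $m\times n$ block mapping $R$, which assigns to each tile type of $T$ a full $m\times n$ rectangle of tile types of $T'$, let $M_R(A)$ be the assembly obtained from an assembly $A$ over $T$ by replacing each tile, of type $t$ at $(x,y)$, by the tiles of types $R(t)(i,j)$ at $(mx+i,ny+j)$, $0\le i<m$, $0\le j<n$. A tile system $\Gamma'=(T',\sigma',\tau')$ \emph{robustly simulates $\Gamma=(T,\sigma,\tau)$ for the concentration distribution $P$ on $T$ at scale factor $m\times n$} if there is an $m\times n$ block mapping $R$ such that $M_R$ is a bijection from $\mathrm{TERM}_\Gamma$ onto $\mathrm{TERM}_{\Gamma'}$ and $$\Pr{}^{P}[\Gamma\to A]=\Pr{}^{C}[\Gamma'\to M_R(A)]$$ for all $A\in\mathrm{TERM}_\Gamma$ and all concentration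 distributions $C$ on $T'$. \textbf{Theorem.} For every unidirectional two-choice linear assembly system $\Gamma=(T,\sigma,2)$ there is a tile system $\Gamma_s=(T',\sigma',\tau')$ with $|T'|=20\,|T|$ that robustly simulates $\Gamma$ for the uniform concentration distribution on $T$ at scale factor $5\times 4$. -/

import Mathlib

open scoped ENNReal NNReal

namespace ATAM

/-- The four sides of a unit square tile. -/
inductive Side
  | north | east | south | west
  deriving DecidableEq

instance : Fintype Side where
  elems := {.north, .east, .south, .west}
  complete := by intro d; cases d <;> decide

/-- The opposite side. -/
def Side.opp : Side → Side
  | .north => .south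
  | .east => .west
  | .south => .north
  | .west => .east

/-- The unit vector pointing out of a side: the cell that faces side `d` of the cell `p` is
`p + d.vec`. -/
def Side.vec : Side → ℤ × ℤ
  | .north => (0, 1)
  | .east => (1, 0)
  | .south => (0, -1)
  | .west => (-1, 0)

/-- A (finite) assembly over the tile types `T`: finitely many cells of `ℤ²` are occupied, each by
one translated copy of a tile type. -/
@[ext]
structure Assembly (T : Type*) where
  cell : ℤ × ℤ → Option T
  finite_cells : {p | cell p ≠ none}.Finite

namespace Assembly

variable {T : Type*}

/-- The set of occupied cells. -/
noncomputable def dom (A : Assembly T) : Finset (ℤ × ℤ) := A.finite_cells.toFinset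

/-- The assembly `A ∪ {b}`, where `b` is the tile of type `t` at the cell `p`. (It is used only
for cells `p` that `A` leaves empty.) -/
def place (A : Assembly T) (p : ℤ × ℤ) (t : T) : Assembly T where
  cell := Function.update A.cell p (some t)
  finite_cells := by
    refine (A.finite_cells.insert p).subset ?_
    intro q hq
    by_cases h : q = p
    · exact Set.mem_insert_iff.mpr (Or.inl h)
    · refine Set.mem_insert_iff.mpr (Or.inr ?_)
      simpa [Function.update_of_ne h] using hq

/-- The assembly is a `1 × n` line: `n` consecutive cells of one row. -/
def IsLine (A : Assembly T) (n : ℕ) : Prop :=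
  ∃ x y : ℤ, ∀ p : ℤ × ℤ, p ∈ A.dom ↔ p.2 = y ∧ x ≤ p.1 ∧ p.1 < x + n

/-- Replace every tile of the assembly by an `m × n` block of tiles, according to the block
mapping `R`: a tile of type `t` at `(x, y)` becomes the tiles `R t i j` at
`(m x + i, n y + j)` for `0 ≤ i < m`, `0 ≤ j < n`. -/
def blockReplace {T' : Type*} {m n : ℕ} [NeZero m] [NeZero n] (R : T → Fin m → Fin n → T')
    (A : Assembly T) : Assembly T' where
  cell p := (A.cell (p.1 / m, p.2 / n)).map fun t =>
    R t (Fin.ofNat m (p.1 % m).toNat) (Fin.ofNat n (p.2 % n).toNat)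
  finite_cells := by
    have hm : (0 : ℤ) < m := by exact_mod_cast Nat.pos_of_neZero m
    have hn : (0 : ℤ) < n := by exact_mod_cast Nat.pos_of_neZero n
    refine ((A.finite_cells.prod (Set.finite_Ico (0 : ℤ) m |>.prod (Set.finite_Ico (0 : ℤ) n))).image
      (fun z : (ℤ × ℤ) × (ℤ × ℤ) => (m * z.1.1 + z.2.1, n * z.1.2 + z.2.2))).subset ?_
    intro p hp
    refine ⟨((p.1 / m, p.2 / n), (p.1 % m, p.2 % n)), ⟨?_, ?_, ?_⟩, ?_⟩
    · intro h
      apply hp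
      simp only at h
      simp [h]
    · exact ⟨Int.emod_nonneg _ hm.ne', Int.emod_lt_of_pos _ hm⟩
    · exact ⟨Int.emod_nonneg _ hn.ne', Int.emod_lt_of_pos _ hn⟩
    · exact Prod.ext (Int.mul_ediv_add_emod _ _) (Int.mul_ediv_add_emod _ _)

open Classical in
/-- The weight of the edge between the cells `p` and `q` in the bond graph of `A`: if both are
occupied and adjacent and the two tiles carry the same glue on their common edge, it is the
strength of that glue, and otherwise it is `0`. -/
noncomputable def bond {G : Type*} (glue : T → Side → G) (str : G → ℕ) (A : Assembly T)
    (p q : ℤ × ℤ) : ℕ :=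
  match A.cell p, A.cell q with
  | some a, some b =>
      ∑ d : Side, if q = p + d.vec ∧ glue a d = glue b d.opp then str (glue a d) else 0
  | _, _ => 0

/-- `τ`-stability: every cut of the bond graph into two nonempty parts has weight at least `τ`. -/
def Stable {G : Type*} (glue : T → Side → G) (str : G → ℕ) (τ : ℕ) (A : Assembly T) : Prop :=
  ∀ S ⊆ A.dom, S.Nonempty → S ≠ A.dom →
    τ ≤ ∑ p ∈ S, ∑ q ∈ A.dom \ S, A.bond glue str p q

end Assembly

/-- A tile system of the abstract Tile Assembly Model with the tile types `T` and the glue types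
`G`. Tile types with the same four glues may be distinct, as tiles may carry labels. -/
structure TileSystem (T G : Type*) where
  glue : T → Side → G
  str : G → ℕ
  seed : Assembly T
  temperature : ℕ
  temperature_pos : 0 < temperature
  seed_nonempty : seed.dom.Nonempty
  seed_stable : seed.Stable glue str temperature

/-- A concentration distribution over the tile types `T`. -/
structure Concentration (T : Type*) [Fintype T] where
  conc : T → ℝ≥0
  conc_pos : ∀ t, 0 < conc t
  sum_conc : ∑ t, conc t = 1

/-- The uniform concentration distribution. -/
noncomputable def Concentration.uniform (T : Type*) [Fintype T] [Nonempty T] :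
    Concentration T where
  conc _ := (Fintype.card T : ℝ≥0)⁻¹
  conc_pos _ := by
    have : (0 : ℝ≥0) < Fintype.card T := by exact_mod_cast Fintype.card_pos
    positivity
  sum_conc := by
    have : (Fintype.card T : ℝ≥0) ≠ 0 := by exact_mod_cast Fintype.card_ne_zero
    simp [Finset.sum_const, this]

namespace TileSystem

variable {T G : Type*} (Γ : TileSystem T G)

/-- The frontier of `A`: the tiles `(p, t)` (type `t` at the empty cell `p`) such that `A` with
this tile added is `τ`-stable. -/
def frontier (A : Assembly T) : Set ((ℤ × ℤ) × T) :=
  {b | A.cell b.1 = none ∧ (A.place b.1 b.2).Stable Γ.glue Γ.str Γ.temperature}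

/-- The producible assemblies. -/
inductive Producible : Assembly T → Prop
  | seed : Producible Γ.seed
  | attach {A : Assembly T} {p : ℤ × ℤ} {t : T} :
      Producible A → (p, t) ∈ Γ.frontier A → Producible (A.place p t)

/-- The terminal assemblies: the producible ones with empty frontier. -/
def terminal : Set (Assembly T) := {A | Γ.Producible A ∧ Γ.frontier A = ∅}

/-- `k`-extensibility: each producible assembly can grow in at most `k` locations. -/
def IsExtensible (k : ℕ) : Prop :=
  ∀ A, Γ.Producible A → (Prod.fst '' Γ.frontier A).encard ≤ k

/-- Unidirectional two-choice linear assembly systems. -/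
structure IsUnidirectionalTwoChoiceLinear : Prop where
  extensible : Γ.IsExtensible 1
  two_choice : ∀ A, Γ.Producible A → (Γ.frontier A).encard ≤ 2
  linear : ∀ A, Γ.Producible A → ∃ n, A.IsLine n

section Probability

variable [Fintype T]

open Classical in
/-- The probability of the transition from `A` to `B` by the attachment of a single tile: the
concentration of the attached tile type, divided by the sum of these concentrations over all
possible attachments to `A`. It is `0` if no single attachment leads from `A` to `B`, so in
particular if `A` is terminal. -/
noncomputable def trans (P : Concentration T) (A B : Assembly T) : ℝ≥0∞ :=
  (∑' b : Γ.frontier A, if A.place b.1.1 b.1.2 = B then (P.conc b.1.2 : ℝ≥0∞) else 0) /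
    ∑' b : Γ.frontier A, (P.conc b.1.2 : ℝ≥0∞)

open Classical in
/-- The probability that the assembly process, started at the seed, makes `n` attachments and is
at the assembly `A` after them. -/
noncomputable def probAfter (P : Concentration T) : ℕ → Assembly T → ℝ≥0∞
  | 0, A => if A = Γ.seed then 1 else 0
  | n + 1, B => ∑' A, probAfter P n A * Γ.trans P A B

/-- For terminal `A`, the probability that the process ends in `A`. The process can be at `A` for
at most one number `n` of attachments, and then stops there. -/
noncomputable def termProb (P : Concentration T) (A : Assembly T) : ℝ≥0∞ :=
  ∑' n, Γ.probAfter P n A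

/-- `Γ.RobustlySimulates Γ₀ P m n`: there is an `m × n` block mapping for which block replacement
is a bijection from the terminal assemblies of `Γ₀` onto those of `Γ`, and which carries the
probabilities of the terminal assemblies of `Γ₀` under `P` to those of `Γ` under every
concentration distribution over the tile types of `Γ`. -/
def RobustlySimulates {T₀ G₀ : Type*} [Fintype T₀] (Γ₀ : TileSystem T₀ G₀)
    (P : Concentration T₀) (m n : ℕ) [NeZero m] [NeZero n] : Prop :=
  ∃ R : T₀ → Fin m → Fin n → T,
    Set.BijOn (Assembly.blockReplace R) Γ₀.terminal Γ.terminal ∧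
    ∀ A ∈ Γ₀.terminal, ∀ C : Concentration T,
      Γ₀.termProb P A = Γ.termProb C (A.blockReplace R)

end Probability

end TileSystem

end ATAM

namespace ATAM

/-! Each tile of the row becomes a `5 × 4` block that contains a fair coin whatever the
concentrations are. Up to reflection the row grows to the east only. The next tile is then
determined by one glue, so the candidates are exactly the tile types with a given west glue. There
are at most two: a representative `ρ` and possibly one other type `t`. The tile types of the
simulator are pairs of a tile type and a cell of the block (its role), which gives `20 |T|`.

A block grows in three phases. An early path of strength-2 glues, labelled only by `ρ`, leads from
the exit `(4, 3)` of the previous block to the trigger `(1, 2)`. Next, `heads` can attach at `(0,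
2)` and `tails` at `(1, 1)`, each by two unit bonds. The same two tile types also compete for the
contested cell `(0, 1)`, where one bond comes from the previous block and the other from the already
placed opponent. Finally, the winner at `(0, 1)` selects whether the late path carries `ρ` or `t`.
That path ends in the next exit and waits at `(1, 0)` until `(1, 1)` is filled.

The coin is fair because let `a` and `b = 1 - a` be the relative concentrations of `heads` and
`tails`. If `heads` comes first, a tile of type `tails` can go to `(1, 1)` or to the contested cell.
The type is the same, so each has probability `1/2`. The case of `tails` first is symmetric. With
both placed, the contested cell goes to `heads` with probability `a`. Thus `heads` wins with
probability `a * (a / 2) + b * (1 / 2 + a / 2) = 1/2` (`hit_trigger_of_paired`). If `ρ` has no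
partner, one glue is changed so that `tails` cannot take the contested cell, and every order of
attachment ends with `heads` (`hit_trigger_of_not_paired`).

Three further points need proof. Nothing attaches outside the block under construction
(`attachWeight_outside`). An attachment that may be delayed does not affect the outcome: a tile in
an enclosed cell may be placed at once (`hit_place_of_enclosed`). The blown-up seed is stable
(`mem_iff_of_block`, `stable_blockReplace`).

Probabilities are handled through `hit`, the probability to pass through a fixed assembly as a
function of the starting assembly. It satisfies the one-step equation `hit_eq`, and `step_cases`
shows that the hitting probabilities of both systems obey the same recursion, so they agree by
induction on the size. The same recursion gives surjectivity on terminal assemblies: a producible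
assembly is hit with nonzero probability, while a terminal one outside the image would be hit with
probability zero. -/

theorem Side.opp_opp (d : Side) : d.opp.opp = d := by cases d <;> rfl

theorem Side.vec_opp (d : Side) : d.opp.vec = -d.vec := by cases d <;> rfl

theorem Side.vec_injective : Function.Injective Side.vec := by
  intro a b; cases a <;> cases b <;> decide

/-! ### Attachment weights, stability of one-tile extensions, and light cuts -/

namespace Assembly

variable {T G : Type*}

theorem mem_dom {A : Assembly T} {p : ℤ × ℤ} : p ∈ A.dom ↔ A.cell p ≠ none := by
  simp [dom]

theorem cell_place_self (A : Assembly T) (p : ℤ × ℤ) (t : T) : (A.place p t).cell p = some t := by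
  simp [place]

theorem cell_place_of_ne (A : Assembly T) {p q : ℤ × ℤ} (t : T) (h : q ≠ p) :
    (A.place p t).cell q = A.cell q := by
  simp [place, Function.update_of_ne h]

theorem dom_place (A : Assembly T) (p : ℤ × ℤ) (t : T) : (A.place p t).dom = insert p A.dom := by
  ext q
  by_cases h : q = p
  · subst h; simp [mem_dom, cell_place_self]
  · simp [mem_dom, cell_place_of_ne A t h, h]

theorem card_dom_place {A : Assembly T} {p : ℤ × ℤ} (t : T) (h : A.cell p = none) :
    (A.place p t).dom.card = A.dom.card + 1 := by
  rw [dom_place, Finset.card_insert_of_notMem]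
  simp [mem_dom, h]

theorem place_comm (A : Assembly T) {p q : ℤ × ℤ} (s t : T) (h : p ≠ q) :
    (A.place p s).place q t = (A.place q t).place p s := by
  ext1
  exact Function.update_comm h.symm _ _ _ |>.symm

open Classical in
/-- The strength of the bond that a tile of type `t` would form on its side `d` with the content of
the cell there. -/
noncomputable def bondWith (glue : T → Side → G) (str : G → ℕ) (t : T) (d : Side) : Option T → ℕ
  | some a => if glue t d = glue a d.opp then str (glue t d) else 0
  | none => 0

open Classical in
theorem bondWith_some (glue : T → Side → G) (str : G → ℕ) (t : T) (d : Side) (a : T) :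
    bondWith glue str t d (some a) = if glue t d = glue a d.opp then str (glue t d) else 0 := rfl

theorem bondWith_none (glue : T → Side → G) (str : G → ℕ) (t : T) (d : Side) :
    bondWith glue str t d none = 0 := rfl

/-- The total strength of the bonds that a tile of type `t` at the empty cell `p` would form. -/
noncomputable def attachWeight (glue : T → Side → G) (str : G → ℕ) (A : Assembly T)
    (p : ℤ × ℤ) (t : T) : ℕ :=
  ∑ d : Side, bondWith glue str t d (A.cell (p + d.vec))

theorem attachWeight_place (glue : T → Side → G) (str : G → ℕ) (A : Assembly T) {p q : ℤ × ℤ}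
    (s t : T) (h : ∀ d : Side, p + d.vec ≠ q) :
    (A.place q s).attachWeight glue str p t = A.attachWeight glue str p t := by
  unfold attachWeight
  refine Finset.sum_congr rfl fun d _ => ?_
  rw [cell_place_of_ne _ _ (h d)]

theorem bond_comm (glue : T → Side → G) (str : G → ℕ) (A : Assembly T) (p q : ℤ × ℤ) :
    A.bond glue str p q = A.bond glue str q p := by
  unfold bond
  rcases hp : A.cell p with _ | a <;> rcases hq : A.cell q with _ | b <;> simp only
  refine Finset.sum_nbij' Side.opp Side.opp (by simp) (by simp)
    (fun d _ => d.opp_opp) (fun d _ => d.opp_opp) ?_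
  intro d _
  have h1 : q = p + d.vec ↔ p = q + d.opp.vec := by
    rw [Side.vec_opp]; constructor <;> rintro rfl <;> simp
  by_cases h : glue a d = glue b d.opp
  · simp [h1, h, Side.opp_opp]
  · have h' : ¬ glue b d.opp = glue a d := fun e => h e.symm
    simp [h, h', Side.opp_opp]

theorem bond_congr (glue : T → Side → G) (str : G → ℕ) {A B : Assembly T} {p q : ℤ × ℤ}
    (hp : A.cell p = B.cell p) (hq : A.cell q = B.cell q) :
    A.bond glue str p q = B.bond glue str p q := by
  unfold bond
  rw [hp, hq]

theorem sum_bond_place (glue : T → Side → G) (str : G → ℕ) {A : Assembly T} {p : ℤ × ℤ} (t : T)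
    (h : A.cell p = none) :
    ∑ q ∈ A.dom, (A.place p t).bond glue str p q = A.attachWeight glue str p t := by
  classical
  have key : ∀ q ∈ A.dom, (A.place p t).bond glue str p q =
      ∑ d : Side, if q = p + d.vec then bondWith glue str t d (A.cell (p + d.vec)) else 0 := by
    intro q hq
    have hqp : q ≠ p := by rintro rfl; exact (mem_dom.1 hq) h
    obtain ⟨a, ha⟩ := Option.ne_none_iff_exists'.1 (mem_dom.1 hq)
    unfold bond
    rw [cell_place_self, cell_place_of_ne _ _ hqp, ha]
    refine Finset.sum_congr rfl fun d _ => ?_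
    by_cases hd : q = p + d.vec
    · rw [← hd, ha]; simp [bondWith]
    · simp [hd]
  rw [Finset.sum_congr rfl key, Finset.sum_comm]
  unfold attachWeight
  refine Finset.sum_congr rfl fun d _ => ?_
  rw [Finset.sum_ite_eq']
  split_ifs with hd
  · rfl
  · have : A.cell (p + d.vec) = none := by simpa [mem_dom] using hd
    rw [this]; rfl

/-- A cut of the enlarged assembly either isolates the new tile, and then weighs exactly
`attachWeight`, or restricts to a proper cut of the stable assembly `A`. Nonemptiness of `A` makes
`{p}` a proper cut. -/
theorem place_stable_iff {glue : T → Side → G} {str : G → ℕ} {τ : ℕ} {A : Assembly T}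
    (hA : A.Stable glue str τ) (hne : A.dom.Nonempty) {p : ℤ × ℤ} (hp : A.cell p = none) (t : T) :
    (A.place p t).Stable glue str τ ↔ τ ≤ A.attachWeight glue str p t := by
  classical
  have hpd : p ∉ A.dom := by simp [mem_dom, hp]
  have hcell : ∀ q ∈ A.dom, (A.place p t).cell q = A.cell q := fun q hq =>
    cell_place_of_ne _ _ (by rintro rfl; exact hpd hq)
  constructor
  · intro h
    have := h {p} (by simp [dom_place]) (by simp) (by
      rw [dom_place]
      intro e
      obtain ⟨q, hq⟩ := hne
      have : q ∈ ({p} : Finset (ℤ × ℤ)) := e ▸ Finset.mem_insert_of_mem hq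
      rw [Finset.mem_singleton] at this
      exact hpd (this ▸ hq))
    rwa [Finset.sum_singleton, dom_place, Finset.sdiff_singleton_eq_erase,
      Finset.erase_insert hpd, sum_bond_place glue str t hp] at this
  · intro hw S hS hSne hSdom
    rw [dom_place] at hS hSdom ⊢
    by_cases hpS : p ∈ S
    · have hd : insert p A.dom \ S = A.dom \ S.erase p := by
        ext q; simp only [Finset.mem_sdiff, Finset.mem_insert, Finset.mem_erase]
        constructor
        · rintro ⟨rfl | h1, h2⟩
          · exact absurd hpS h2
          · exact ⟨h1, fun h => h2 h.2⟩
        · rintro ⟨h1, h2⟩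
          exact ⟨Or.inr h1, fun h => h2 ⟨by rintro rfl; exact hpd h1, h⟩⟩
      have hsub : S.erase p ⊆ A.dom := by
        intro q hq
        rw [Finset.mem_erase] at hq
        exact (Finset.mem_insert.1 (hS hq.2)).resolve_left hq.1
      rw [hd]
      rcases (S.erase p).eq_empty_or_nonempty with he | he
      · have hSp : S = {p} := by
          rw [← Finset.insert_erase hpS, he]; rfl
        rw [he, Finset.sdiff_empty, hSp, Finset.sum_singleton, sum_bond_place glue str t hp]
        exact hw
      · have h1 := hA (S.erase p) hsub he (by
          rintro e; exact hSdom (by rw [← e, Finset.insert_erase hpS]))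
        refine h1.trans ?_
        refine le_trans (le_of_eq ?_) (Finset.sum_le_sum_of_subset (Finset.erase_subset p S))
        refine Finset.sum_congr rfl fun x hx => Finset.sum_congr rfl fun y hy => ?_
        exact bond_congr _ _ (hcell x (hsub hx)).symm (hcell y (Finset.mem_sdiff.1 hy).1).symm
    · have hsub : S ⊆ A.dom := fun q hq =>
        (Finset.mem_insert.1 (hS hq)).resolve_left (by rintro rfl; exact hpS hq)
      by_cases hSA : S = A.dom
      · have hd : insert p A.dom \ S = {p} := by
          rw [hSA, Finset.insert_sdiff_of_notMem _ hpd, Finset.sdiff_self]; rfl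
        rw [hd, hSA]
        simp only [Finset.sum_singleton]
        rw [Finset.sum_congr rfl fun q _ => bond_comm glue str (A.place p t) q p,
          sum_bond_place glue str t hp]
        exact hw
      · refine (hA S hsub hSne hSA).trans ?_
        refine Finset.sum_le_sum fun x hx => ?_
        refine le_trans (le_of_eq ?_) (Finset.sum_le_sum_of_subset
          (Finset.sdiff_subset_sdiff (Finset.subset_insert p A.dom) le_rfl))
        refine Finset.sum_congr rfl fun y hy => ?_
        exact bond_congr _ _ (hcell x (hsub hx)).symm (hcell y (Finset.mem_sdiff.1 hy).1).symm

/-- Two bonded pairs of cells, each joined by a positive bond, cannot both be separated by a cut of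
weight less than two. -/
theorem not_separated_pair {glue : T → Side → G} {str : G → ℕ} {A : Assembly T}
    {S : Finset (ℤ × ℤ)} (hS : ∑ p ∈ S, ∑ q ∈ A.dom \ S, A.bond glue str p q < 2)
    {p₁ q₁ p₂ q₂ : ℤ × ℤ} (h₁ : 0 < A.bond glue str p₁ q₁) (h₂ : 0 < A.bond glue str p₂ q₂)
    (hne : (p₁ ≠ p₂ ∨ q₁ ≠ q₂) ∧ (p₁ ≠ q₂ ∨ q₁ ≠ p₂)) :
    (p₁ ∈ S ↔ q₁ ∈ S) ∨ (p₂ ∈ S ↔ q₂ ∈ S) := by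
  classical
  by_contra hcon
  push Not at hcon
  have hdom : ∀ {p q}, 0 < A.bond glue str p q → p ∈ A.dom ∧ q ∈ A.dom := by
    intro p q h
    unfold bond at h
    rcases hp : A.cell p with _ | a <;> rcases hq : A.cell q with _ | b <;>
      simp [hp, hq, mem_dom] at h ⊢
  have orient : ∀ {p q}, 0 < A.bond glue str p q → ¬ (p ∈ S ↔ q ∈ S) →
      ∃ e ∈ S ×ˢ (A.dom \ S), 0 < A.bond glue str e.1 e.2 ∧ (e = (p, q) ∨ e = (q, p)) := by
    intro p q h hc
    by_cases hp : p ∈ S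
    · exact ⟨(p, q), by simp [hp, (hdom h).2]; tauto, h, Or.inl rfl⟩
    · refine ⟨(q, p), ?_, by simpa [bond_comm] using (bond_comm glue str A p q) ▸ h, Or.inr rfl⟩
      simp [hp, (hdom h).1]; tauto
  obtain ⟨e₁, he₁, hb₁, ho₁⟩ := orient h₁ (by tauto)
  obtain ⟨e₂, he₂, hb₂, ho₂⟩ := orient h₂ (by tauto)
  have hne' : e₁ ≠ e₂ := by
    rcases ho₁ with rfl | rfl <;> rcases ho₂ with rfl | rfl <;>
      · intro e; simp only [Prod.mk.injEq] at e; obtain ⟨e1, e2⟩ := e; subst e1; subst e2; simp at hne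
  rw [← Finset.sum_product'] at hS
  have hle : ∑ e ∈ {e₁, e₂}, A.bond glue str e.1 e.2 ≤
      ∑ e ∈ S ×ˢ (A.dom \ S), A.bond glue str e.1 e.2 :=
    Finset.sum_le_sum_of_subset (by
      intro e he
      rw [Finset.mem_insert, Finset.mem_singleton] at he
      rcases he with rfl | rfl <;> assumption)
  rw [Finset.sum_pair hne'] at hle
  omega

theorem not_separated {glue : T → Side → G} {str : G → ℕ} {A : Assembly T}
    {S : Finset (ℤ × ℤ)} (hS : ∑ p ∈ S, ∑ q ∈ A.dom \ S, A.bond glue str p q < 2)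
    {p q : ℤ × ℤ} (h : 2 ≤ A.bond glue str p q) : p ∈ S ↔ q ∈ S := by
  classical
  have hdom : p ∈ A.dom ∧ q ∈ A.dom := by
    unfold bond at h
    rcases hp : A.cell p with _ | a <;> rcases hq : A.cell q with _ | b <;>
      simp [hp, hq, mem_dom] at h ⊢
  have main : ∀ {p q}, 2 ≤ A.bond glue str p q → q ∈ A.dom → p ∈ S → q ∈ S := by
    intro p q h hq hp
    by_contra hqS
    have h1 := Finset.single_le_sum (f := fun q => A.bond glue str p q) (fun _ _ => Nat.zero_le _)
      (Finset.mem_sdiff.2 ⟨hq, hqS⟩)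
    have h2 := Finset.single_le_sum (f := fun p => ∑ q ∈ A.dom \ S, A.bond glue str p q)
      (fun _ _ => Nat.zero_le _) hp
    omega
  exact ⟨main h hdom.2, main (bond_comm glue str A p q ▸ h) hdom.1⟩

end Assembly

/-! ### Frontiers in terms of attachment weights -/

namespace TileSystem

variable {T G : Type*} {Γ : TileSystem T G}

theorem Producible.stable {A : Assembly T} (h : Γ.Producible A) :
    A.Stable Γ.glue Γ.str Γ.temperature := by
  cases h with
  | seed => exact Γ.seed_stable
  | attach _ hf => exact hf.2

theorem Producible.nonempty {A : Assembly T} (h : Γ.Producible A) : A.dom.Nonempty := by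
  cases h with
  | seed => exact Γ.seed_nonempty
  | attach _ hf => rw [Assembly.dom_place]; exact Finset.insert_nonempty _ _

theorem Producible.mem_frontier_iff {A : Assembly T} (h : Γ.Producible A) {p : ℤ × ℤ} {t : T} :
    (p, t) ∈ Γ.frontier A ↔
      A.cell p = none ∧ Γ.temperature ≤ A.attachWeight Γ.glue Γ.str p t := by
  constructor
  · rintro ⟨h1, h2⟩
    exact ⟨h1, (Assembly.place_stable_iff h.stable h.nonempty h1 t).1 h2⟩
  · rintro ⟨h1, h2⟩
    exact ⟨h1, (Assembly.place_stable_iff h.stable h.nonempty h1 t).2 h2⟩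

/-- Since the temperature is positive, an attachable tile needs an occupied neighbour. Finiteness
keeps the normalising sums of concentrations below `⊤`. -/
theorem Producible.frontier_finite [Finite T] {A : Assembly T} (h : Γ.Producible A) :
    (Γ.frontier A).Finite := by
  classical
  have : (Γ.frontier A) ⊆
      (((A.dom ×ˢ (Finset.univ : Finset Side)).image fun x => x.1 - x.2.vec : Finset (ℤ × ℤ)) :
        Set (ℤ × ℤ)) ×ˢ (Set.univ : Set T) := by
    rintro ⟨p, t⟩ hb
    have hw := (h.mem_frontier_iff.1 hb).2
    have hpos := lt_of_lt_of_le Γ.temperature_pos hw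
    obtain ⟨d, -, hd⟩ := Finset.exists_ne_zero_of_sum_ne_zero (Nat.pos_iff_ne_zero.1 hpos)
    refine ⟨?_, trivial⟩
    simp only [Finset.coe_image, Set.mem_image, Finset.mem_coe, Finset.mem_product]
    refine ⟨(p + d.vec, d), ⟨?_, Finset.mem_univ _⟩, by simp⟩
    rw [Assembly.mem_dom]
    intro e
    simp [e, Assembly.bondWith] at hd
  exact (Set.Finite.prod (Finset.finite_toSet _) Set.finite_univ).subset this

/-! ### Hitting probabilities and the one-step equation -/

section Probability

variable [Fintype T]

/-- The expected value of `f` after one attachment to `A`. -/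
noncomputable def step (Γ : TileSystem T G) (P : Concentration T) (f : Assembly T → ℝ≥0∞)
    (A : Assembly T) : ℝ≥0∞ :=
  (∑' b : Γ.frontier A, (P.conc b.1.2 : ℝ≥0∞) * f (A.place b.1.1 b.1.2)) /
    ∑' b : Γ.frontier A, (P.conc b.1.2 : ℝ≥0∞)

theorem tsum_trans_mul (P : Concentration T) (A : Assembly T) (f : Assembly T → ℝ≥0∞) :
    ∑' B, Γ.trans P A B * f B = Γ.step P f A := by
  classical
  simp only [trans, step, div_eq_mul_inv]
  have : ∀ B, (∑' b : Γ.frontier A,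
      if A.place b.1.1 b.1.2 = B then (P.conc b.1.2 : ℝ≥0∞) else 0) *
      (∑' b : Γ.frontier A, (P.conc b.1.2 : ℝ≥0∞))⁻¹ * f B =
      (∑' b : Γ.frontier A, if B = A.place b.1.1 b.1.2 then
        (P.conc b.1.2 : ℝ≥0∞) * f (A.place b.1.1 b.1.2) else 0) *
      (∑' b : Γ.frontier A, (P.conc b.1.2 : ℝ≥0∞))⁻¹ := by
    intro B
    rw [mul_right_comm, ← ENNReal.tsum_mul_right]
    congr 2
    funext b
    by_cases h : A.place b.1.1 b.1.2 = B
    · simp [h]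
    · have h' : ¬ B = A.place b.1.1 b.1.2 := fun e => h e.symm
      simp [h, h']
  rw [tsum_congr this, ENNReal.tsum_mul_right, ENNReal.tsum_comm]
  congr 2
  funext b
  exact tsum_ite_eq _ _

open Classical in
/-- The probability to be at `X` after `n` attachments to a given assembly. -/
noncomputable def walk (Γ : TileSystem T G) (P : Concentration T) (X : Assembly T) :
    ℕ → Assembly T → ℝ≥0∞
  | 0 => fun A => if A = X then 1 else 0
  | n + 1 => Γ.step P (walk Γ P X n)

/-- The Chapman–Kolmogorov equation, which passes from the forward recursion defining `probAfter` to
the backward recursion of `walk`. -/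
theorem tsum_probAfter_mul_walk (P : Concentration T) (X : Assembly T) (k n : ℕ) :
    ∑' A, Γ.probAfter P n A * Γ.walk P X k A = Γ.probAfter P (n + k) X := by
  classical
  induction k generalizing n with
  | zero =>
    simp only [walk, mul_ite, mul_one, mul_zero, add_zero]
    exact tsum_ite_eq X _
  | succ k ih =>
    have : ∀ A, Γ.probAfter P n A * Γ.walk P X (k + 1) A =
        ∑' B, Γ.probAfter P n A * Γ.trans P A B * Γ.walk P X k B := by
      intro A
      rw [walk, ← tsum_trans_mul, ← ENNReal.tsum_mul_left]
      simp only [mul_assoc]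
    rw [tsum_congr this, ENNReal.tsum_comm]
    simp only [ENNReal.tsum_mul_right]
    have h := ih (n + 1)
    rw [show n + 1 + k = n + (k + 1) by ring] at h
    exact h

/-- The probability that the growth from a given assembly passes through `X`. -/
noncomputable def hit (Γ : TileSystem T G) (P : Concentration T) (X A : Assembly T) : ℝ≥0∞ :=
  ∑' n, Γ.walk P X n A

theorem termProb_eq_hit (P : Concentration T) (X : Assembly T) :
    Γ.termProb P X = Γ.hit P X Γ.seed := by
  classical
  unfold termProb hit
  refine tsum_congr fun n => ?_
  have h := tsum_probAfter_mul_walk (Γ := Γ) P X n 0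
  rw [zero_add] at h
  rw [← h]
  simp only [probAfter, ite_mul, one_mul, zero_mul]
  exact tsum_ite_eq Γ.seed _

open Classical in
-- First-step analysis. No convergence question arises, as all sums are in `ℝ≥0∞`.
theorem hit_eq (P : Concentration T) (X A : Assembly T) :
    Γ.hit P X A = (if A = X then 1 else 0) + Γ.step P (Γ.hit P X) A := by
  have h1 : Γ.hit P X A = Γ.walk P X 0 A + ∑' n, Γ.walk P X (n + 1) A :=
    tsum_eq_zero_add' ENNReal.summable
  rw [h1]
  congr 1
  simp only [walk, step, hit, div_eq_mul_inv, ENNReal.tsum_mul_right]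
  congr 1
  rw [ENNReal.tsum_comm]
  simp only [ENNReal.tsum_mul_left]

theorem step_of_frontier_eq_empty {P : Concentration T} {f : Assembly T → ℝ≥0∞} {A : Assembly T}
    (h : Γ.frontier A = ∅) : Γ.step P f A = 0 := by
  have : IsEmpty (Γ.frontier A) := by rw [h]; infer_instance
  simp [step]

theorem coe_conc_ne_zero (P : Concentration T) (t : T) : (P.conc t : ℝ≥0∞) ≠ 0 := by
  simpa using (P.conc_pos t).ne'

theorem step_singleton {P : Concentration T} {f : Assembly T → ℝ≥0∞} {A : Assembly T}
    {b : (ℤ × ℤ) × T} (h : Γ.frontier A = {b}) : Γ.step P f A = f (A.place b.1 b.2) := by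
  unfold step
  rw [h, tsum_singleton b (fun b => (P.conc b.2 : ℝ≥0∞) * f (A.place b.1 b.2)),
    tsum_singleton b (fun b => (P.conc b.2 : ℝ≥0∞)), mul_comm, mul_div_assoc,
    ENNReal.div_self (coe_conc_ne_zero P _) ENNReal.coe_ne_top, mul_one]

theorem step_pair {P : Concentration T} {f : Assembly T → ℝ≥0∞} {A : Assembly T}
    {b c : (ℤ × ℤ) × T} (hbc : b ≠ c) (h : Γ.frontier A = {b, c}) :
    Γ.step P f A =
      P.conc b.2 / (P.conc b.2 + P.conc c.2) * f (A.place b.1 b.2) +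
      P.conc c.2 / (P.conc b.2 + P.conc c.2) * f (A.place c.1 c.2) := by
  classical
  unfold step
  have e : ({b, c} : Set ((ℤ × ℤ) × T)) = (({b, c} : Finset ((ℤ × ℤ) × T)) : Set _) := by simp
  rw [h, e, Finset.tsum_subtype' {b, c} (fun b => (P.conc b.2 : ℝ≥0∞) * f (A.place b.1 b.2)),
    Finset.tsum_subtype' {b, c} (fun b => (P.conc b.2 : ℝ≥0∞)),
    Finset.sum_pair hbc, Finset.sum_pair hbc]
  simp only [div_eq_mul_inv]
  ring

theorem tsum_conc_ne_zero {P : Concentration T} {s : Set ((ℤ × ℤ) × T)} (hs : s.Nonempty) :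
    ∑' b : s, (P.conc b.1.2 : ℝ≥0∞) ≠ 0 := by
  obtain ⟨b, hb⟩ := hs
  intro h
  exact coe_conc_ne_zero P b.2 (ENNReal.tsum_eq_zero.1 h ⟨b, hb⟩)

theorem tsum_conc_ne_top {P : Concentration T} {s : Set ((ℤ × ℤ) × T)} (hs : s.Finite) :
    ∑' b : s, (P.conc b.1.2 : ℝ≥0∞) ≠ ⊤ := by
  have := hs.fintype
  rw [tsum_fintype]
  exact ENNReal.sum_ne_top.2 fun _ _ => ENNReal.coe_ne_top

/-- With this lemma, forced outcomes need no computation with concentrations: if all continuations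
have the same value, their weights are irrelevant. -/
theorem step_const {P : Concentration T} {f : Assembly T → ℝ≥0∞} {A : Assembly T} {v : ℝ≥0∞}
    (hA : Γ.Producible A) (hne : (Γ.frontier A).Nonempty)
    (h : ∀ p t, (p, t) ∈ Γ.frontier A → f (A.place p t) = v) : Γ.step P f A = v := by
  have : ∑' b : Γ.frontier A, (P.conc b.1.2 : ℝ≥0∞) * f (A.place b.1.1 b.1.2) =
      ∑' b : Γ.frontier A, (P.conc b.1.2 : ℝ≥0∞) * v :=
    tsum_congr fun b => by rw [h _ _ b.2]
  rw [step, this, ENNReal.tsum_mul_right, mul_comm, mul_div_assoc,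
    ENNReal.div_self (tsum_conc_ne_zero hne) (tsum_conc_ne_top hA.frontier_finite), mul_one]

theorem hit_eq_step {P : Concentration T} {X A : Assembly T} (hX : Γ.frontier X = ∅)
    (hA : (Γ.frontier A).Nonempty) : Γ.hit P X A = Γ.step P (Γ.hit P X) A := by
  rw [hit_eq, if_neg, zero_add]
  rintro rfl
  rw [hX] at hA
  exact Set.not_nonempty_empty hA

theorem hit_of_terminal {P : Concentration T} {X A : Assembly T} (hA : Γ.frontier A = ∅)
    (hne : A ≠ X) : Γ.hit P X A = 0 := by
  rw [hit_eq, if_neg hne, step_of_frontier_eq_empty hA, zero_add]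

theorem hit_self_of_terminal {P : Concentration T} {A : Assembly T} (hA : Γ.frontier A = ∅) :
    Γ.hit P A A = 1 := by
  rw [hit_eq, if_pos rfl, step_of_frontier_eq_empty hA, add_zero]

/-- Attachments only enlarge an assembly. This is the base case of all inductions on the remaining
number of tiles. -/
theorem hit_eq_zero_of_card_lt {P : Concentration T} {X A : Assembly T}
    (h : X.dom.card < A.dom.card) : Γ.hit P X A = 0 := by
  have : ∀ n A, X.dom.card < A.dom.card → Γ.walk P X n A = 0 := by
    intro n
    induction n with
    | zero => intro A h; simp only [walk]; rw [if_neg]; rintro rfl; exact lt_irrefl _ h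
    | succ n ih =>
      intro A h
      rw [walk, step]
      have : ∀ b : Γ.frontier A,
          (P.conc b.1.2 : ℝ≥0∞) * Γ.walk P X n (A.place b.1.1 b.1.2) = 0 := by
        intro b
        rw [ih _ (by rw [Assembly.card_dom_place _ b.2.1]; omega), mul_zero]
      simp [this]
  simp [hit, this _ A h]

theorem hit_self_ne_zero (P : Concentration T) (A : Assembly T) : Γ.hit P A A ≠ 0 := by
  rw [hit_eq, if_pos rfl]
  simp

theorem hit_ne_zero_of_attach {P : Concentration T} {X A : Assembly T} (hA : Γ.Producible A)
    {p : ℤ × ℤ} {t : T} (hb : (p, t) ∈ Γ.frontier A) (h : Γ.hit P X (A.place p t) ≠ 0) :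
    Γ.hit P X A ≠ 0 := by
  rw [hit_eq]
  intro h0
  have h1 := (add_eq_zero.1 h0).2
  rw [step, ENNReal.div_eq_zero_iff] at h1
  rcases h1 with h1 | h1
  · have := ENNReal.tsum_eq_zero.1 h1 ⟨(p, t), hb⟩
    exact (mul_ne_zero (coe_conc_ne_zero P t) h) this
  · exact tsum_conc_ne_top hA.frontier_finite h1

/-- All concentrations are positive and all frontiers finite, so each attachment leading to `X`
preserves positivity. It is used to show that every terminal assembly of the simulator is an image.
-/
theorem hit_ne_zero_of_producible {P : Concentration T} {X : Assembly T} (hX : Γ.Producible X) :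
    Γ.hit P X Γ.seed ≠ 0 := by
  suffices ∀ Y, Γ.Producible Y → Γ.hit P X Y ≠ 0 → Γ.hit P X Γ.seed ≠ 0 from
    this X hX (hit_self_ne_zero P X)
  intro Y hY
  induction hY with
  | seed => exact id
  | attach hA hf ih => exact fun h => ih (hit_ne_zero_of_attach hA hf h)

end Probability

/-! ### Attachments at enclosed cells commute with the rest of the growth -/

/-- All neighbours of `p` are occupied, so the tile at `p` contributes to the attachment weight of
no empty cell. -/
theorem frontier_place_iff_of_enclosed {A : Assembly T} {p : ℤ × ℤ} {t : T} (hA : Γ.Producible A)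
    (hpt : (p, t) ∈ Γ.frontier A) (henc : ∀ d : Side, A.cell (p + d.vec) ≠ none)
    {q : ℤ × ℤ} {s : T} : (q, s) ∈ Γ.frontier (A.place p t) ↔ (q, s) ∈ Γ.frontier A ∧ q ≠ p := by
  rw [(hA.attach hpt).mem_frontier_iff, hA.mem_frontier_iff]
  by_cases hqp : q = p
  · subst hqp; simp [Assembly.cell_place_self]
  · rw [Assembly.cell_place_of_ne _ _ hqp]
    constructor
    · rintro ⟨h1, h2⟩
      rw [Assembly.attachWeight_place _ _ _ _] at h2
      · exact ⟨⟨h1, h2⟩, hqp⟩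
      · rintro d rfl
        have := henc d.opp
        rw [Side.vec_opp] at this
        simp [h1] at this
    · rintro ⟨⟨h1, h2⟩, -⟩
      refine ⟨h1, ?_⟩
      rw [Assembly.attachWeight_place _ _ _ _]
      · exact h2
      · rintro d rfl
        have := henc d.opp
        rw [Side.vec_opp] at this
        simp [h1] at this

section

variable [Fintype T]

/-- A tile that will be attached at an empty cell with four occupied neighbours may as well be
attached at once. -/
theorem hit_place_of_enclosed {P : Concentration T} {X : Assembly T} (hX : Γ.frontier X = ∅)
    {A : Assembly T} {p : ℤ × ℤ} {t : T} (hA : Γ.Producible A) (hpt : (p, t) ∈ Γ.frontier A)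
    (huniq : ∀ t', (p, t') ∈ Γ.frontier A → t' = t)
    (henc : ∀ d : Side, A.cell (p + d.vec) ≠ none) :
    Γ.hit P X A = Γ.hit P X (A.place p t) := by
  -- Downward induction on the size of `A`: beyond the size of `X` both sides vanish.
  obtain ⟨k, hk⟩ : ∃ k, X.dom.card + 1 ≤ A.dom.card + k := ⟨X.dom.card + 1, by omega⟩
  induction k generalizing A with
  | zero =>
    rw [hit_eq_zero_of_card_lt (by omega), hit_eq_zero_of_card_lt]
    rw [Assembly.card_dom_place _ hpt.1]; omega
  | succ k ih =>
    have hfr : ∀ {q s}, (q, s) ∈ Γ.frontier (A.place p t) ↔ (q, s) ∈ Γ.frontier A ∧ q ≠ p :=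
      frontier_place_iff_of_enclosed hA hpt henc
    have hval : ∀ q s, (q, s) ∈ Γ.frontier (A.place p t) →
        Γ.hit P X (A.place q s) = Γ.hit P X ((A.place p t).place q s) := by
      intro q s hqs
      obtain ⟨hq, hqp⟩ := hfr.1 hqs
      have hw : ∀ t', (A.place q s).attachWeight Γ.glue Γ.str p t' =
          A.attachWeight Γ.glue Γ.str p t' := fun t' =>
        Assembly.attachWeight_place _ _ _ _ _ fun d hd => henc d (hd ▸ hq.1)
      have hiff : ∀ t', (p, t') ∈ Γ.frontier (A.place q s) ↔ (p, t') ∈ Γ.frontier A := by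
        intro t'
        rw [(hA.attach hq).mem_frontier_iff, hA.mem_frontier_iff, hw,
          Assembly.cell_place_of_ne _ _ (Ne.symm hqp)]
      -- After the attachment at `q`, the cell `p` is still enclosed and still admits only `t`. The
      -- induction hypothesis inserts `t`, and the two attachments commute.
      rw [ih (hA.attach hq) ((hiff t).2 hpt) (fun t' h => huniq t' ((hiff t').1 h)) _ _,
        Assembly.place_comm _ _ _ hqp]
      · intro d
        by_cases e : p + d.vec = q
        · rw [e, Assembly.cell_place_self]; simp
        · rw [Assembly.cell_place_of_ne _ _ e]; exact henc d
      · rw [Assembly.card_dom_place _ hq.1]; omega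
    rw [hit_eq_step hX ⟨_, hpt⟩]
    by_cases hne : (Γ.frontier (A.place p t)).Nonempty
    · set F := Γ.frontier (A.place p t) with hF
      have hins : Γ.frontier A = {(p, t)} ∪ F := by
        ext ⟨q, s⟩
        rw [Set.mem_union, hfr, Set.mem_singleton_iff, Prod.mk.injEq]
        constructor
        · intro h
          by_cases hqp : q = p
          · subst hqp; exact Or.inl ⟨rfl, huniq s h⟩
          · exact Or.inr ⟨h, hqp⟩
        · rintro (⟨rfl, rfl⟩ | h)
          · exact hpt
          · exact h.1
      have hdisj : Disjoint {(p, t)} F := by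
        rw [Set.disjoint_singleton_left, hfr]
        exact fun h => h.2 rfl
      have hsum : ∀ g : (ℤ × ℤ) × T → ℝ≥0∞,
          ∑' b : Γ.frontier A, g b = g (p, t) + ∑' b : F, g b := by
        intro g
        rw [hins, ENNReal.summable.tsum_union_disjoint hdisj ENNReal.summable,
          tsum_singleton (p, t) g]
      have hfin : F.Finite := (hA.attach hpt).frontier_finite
      have hF0 : ∑' b : F, (P.conc b.1.2 : ℝ≥0∞) ≠ 0 := tsum_conc_ne_zero hne
      have hFt : ∑' b : F, (P.conc b.1.2 : ℝ≥0∞) ≠ ⊤ := tsum_conc_ne_top hfin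
      -- The attachments other than `(p, t)` contribute `V` times their total concentration, where
      -- `V` is the value after placing `t`. Since `(p, t)` contributes `V` as well, the weighted
      -- mean is `V`.
      have hh : ∑' b : F, (P.conc b.1.2 : ℝ≥0∞) * Γ.hit P X (A.place b.1.1 b.1.2) =
          Γ.hit P X (A.place p t) * ∑' b : F, (P.conc b.1.2 : ℝ≥0∞) := by
        rw [hit_eq_step hX hne, step, ENNReal.div_mul_cancel hF0 hFt]
        exact tsum_congr fun b => by rw [hval _ _ b.2]
      rw [step, hsum (fun b => (P.conc b.2 : ℝ≥0∞) * Γ.hit P X (A.place b.1 b.2)),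
        hsum (fun b => (P.conc b.2 : ℝ≥0∞)), hh, mul_comm (P.conc t : ℝ≥0∞), ← mul_add,
        mul_div_assoc, ENNReal.div_self, mul_one]
      · exact fun h => hF0 (add_eq_zero.1 h).2
      · exact ENNReal.add_ne_top.2 ⟨ENNReal.coe_ne_top, hFt⟩
    · refine step_const hA ⟨_, hpt⟩ fun q s hqs => ?_
      by_cases hqp : q = p
      · subst hqp; rw [huniq s hqs]
      · exact absurd ⟨_, hfr.2 ⟨hqs, hqp⟩⟩ hne

end

end TileSystem

end ATAM

/-! ### The coin-flip gadget: roles, glue labels and stages of a block -/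

namespace ATAM

/-- The cells of a `5 × 4` block. The tile types of the simulating system are pairs of a datum and
a role, where the roles are named after the cells of a block. -/
abbrev Role : Type := Fin 5 × Fin 4

namespace Role

/-- Position of a side in the rows of `labelTable`. -/
def sideIndex : Side → ℕ
  | .north => 0
  | .east => 1
  | .south => 2
  | .west => 3

/-- The glue labels of the roles, by columns from left to right, and from bottom to top in each
column; the four labels of a role are those on the sides north, east, south, west. -/
def labelTable : List (List ℕ) :=
  -- Labels 3 and 4 are reused so that `heads` and `tails` fit both their own cells and the
  -- contested one: east label 3 of `heads` meets the trigger or `tails`, and north label 4 of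
  -- `tails` meets the trigger or `heads`. Labels 1 and 2 supply the second bond in their own cells
  -- only. The role `(0, 1)` carries no bonds, because the contested cell is always filled by
  -- `heads` or `tails`; its tile types never appear.
  [[4, 8, 0, 7], [0, 0, 0, 0], [1, 3, 4, 3], [0, 21, 1, 20],
   [4, 29, 0, 8], [4, 2, 4, 3], [0, 28, 4, 3], [0, 22, 0, 21],
   [0, 30, 0, 29], [27, 26, 0, 2], [0, 0, 27, 28], [0, 23, 0, 22],
   [0, 31, 0, 30], [25, 0, 0, 26], [24, 0, 25, 0], [0, 0, 24, 23],
   [32, 7, 0, 31], [33, 3, 32, 0], [34, 0, 33, 0], [0, 20, 34, 0]]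

/-- The glue label on a side of a role. -/
def label (r : Role) (d : Side) : ℕ :=
  (labelTable.getD (4 * r.1 + r.2) []).getD (sideIndex d) 0

/-- The strength of a glue label. -/
def labelStr (l : ℕ) : ℕ := if l = 0 then 0 else if l < 20 then 1 else 2

/-- The role of the tile in whose favour the coin falls if it is attached first to the west of
the trigger. -/
abbrev heads : Role := (0, 2)

/-- The role of the competitor of `heads`, attached to the south of the trigger. -/
abbrev tails : Role := (1, 1)

/-- The cell of a block at which `heads` and `tails` compete. -/
abbrev contested : Role := (0, 1)

/-- The cells that are filled, by a path of tiles, after the coin flip. -/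
def IsLate (r : Role) : Bool := r.2 = 0 || r.1 = 4

/-- The rank of a cell on the path before the coin flip or on the path after it. -/
def rank (r : Role) : ℕ :=
  ([0, 0, 0, 0, 1, 0, 8, 1, 2, 6, 7, 2, 3, 5, 4, 3, 4, 5, 6, 7] : List ℕ).getD (4 * r.1 + r.2) 0

end Role

open Role

/-- How far a block is filled: the number of tiles on the early path, whether the cells of `heads`
and `tails` and the contested cell are occupied, and the number of tiles on the late path. -/
structure Stage where
  early : ℕ
  hasHeads : Bool
  hasTails : Bool
  hasContested : Bool
  late : ℕ

namespace Stage

/-- The cells that are occupied at a stage. -/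
def Filled (S : Stage) (r : Role) : Bool :=
  if r = heads then S.hasHeads
  else if r = tails then S.hasTails
  else if r = contested then S.hasContested
  else if r.IsLate then rank r < S.late
  else rank r < S.early

end Stage

/-- The content of the cell at side `d` of the cell `r` of a block with the contents `m`, if the
block to the west has the contents `w` in its last column, and the other adjacent blocks are
empty. -/
def look {α : Type*} (m : Role → Option α) (w : Fin 4 → α) (r : Role) : Side → Option α
  | .north => if h : r.2.val + 1 < 4 then m (r.1, ⟨r.2 + 1, h⟩) else none
  | .east => if h : r.1.val + 1 < 5 then m (⟨r.1 + 1, h⟩, r.2) else none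
  | .south => if 0 < r.2.val then m (r.1, ⟨r.2 - 1, by omega⟩) else none
  | .west => if 0 < r.1.val then m (⟨r.1 - 1, by omega⟩, r.2) else some (w r.2)

/-- The role of the tile at an occupied cell of a block, where `z` is the role of the tile at the
contested cell. -/
def roleAt (z r : Role) : Role := if r = contested then z else r

/-- The roles in a block at a given stage. -/
def Stage.roles (S : Stage) (z r : Role) : Option Role :=
  if S.Filled r then some (roleAt z r) else none

/-- The strength of the bonds of a tile of role `s` at the cell `r`, as far as labels go. -/
def Stage.bound (S : Stage) (z r s : Role) : ℕ :=
  ([Side.north, Side.east, Side.south, Side.west].map fun d =>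
    match look (S.roles z) (fun j => (4, j)) r d with
    | some a => if label s d = label a d.opp then labelStr (label s d) else 0
    | none => 0).sum

/-- All attachments to a block at the stage `S` that the labels allow are in the list `l`. -/
def Stage.Allows (S : Stage) (z : Role) (l : List (Role × Role)) : Bool :=
  decide (∀ r s, S.Filled r = false → 2 ≤ S.bound z r s → (r, s) ∈ l)

end ATAM

/-! ### Glues of the simulator and coordinates of blocks -/

namespace ATAM

open Role

/-- The data that determine the glues of the simulating system: the representative of the set of
all tile types with the same glue on the west side, and the representative of the set of all tile
types that can be attached to the east. -/
structure ChainData (K : Type*) where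
  rep : K → K
  next : K → Option K

namespace ChainData

variable {K : Type*} (D : ChainData K)

/-- Two or more tile types are represented by `k`. -/
def Paired (k : K) : Prop := ∃ k', k' ≠ k ∧ D.rep k' = k

open Classical in
/-- The part of the glue, besides its label, on a side of a tile type. -/
noncomputable def glueData (a : K × Role) (d : Side) : ℕ × Option K :=
  -- The number separates glues with label 4. A 0 on the south of `heads` lets `tails` bind below
  -- it, which is wanted only if a second tile type exists; otherwise 1 prevents it. The value 2
  -- below `tails` and above `(0, 0)` of a non-representative makes the winner select the type of
  -- the late path. The cell `(1, 0)` knows only the representative of its class on its north side,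
  -- since it lies below `tails` whoever wins.
  if a.2 = heads ∧ d = .south then (if D.Paired a.1 then 0 else 1, some a.1)
  else if a.2 = tails ∧ d = .south then (2, some a.1)
  else if a.2 = (0, 0) ∧ d = .north then
    (if D.rep a.1 = a.1 then if D.Paired a.1 then 0 else 1 else 2, some (D.rep a.1))
  else if a.2 = (1, 0) ∧ d = .north then (2, some (D.rep a.1))
  else if a.2 = (0, 0) ∧ d = .west then (0, none)
  else if a.2 = (4, 0) ∧ d = .east then (0, none)
  else if a.2.1 = 4 ∧ d = .east then (0, D.next a.1)
  else (0, some a.1)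

/-- The glues of the simulating system. -/
noncomputable def glue (a : K × Role) (d : Side) : ℕ × ℕ × Option K :=
  (label a.2 d, D.glueData a d)

open Classical in
/-- The role of the tile at the contested cell of the block that stands for `k`. -/
noncomputable def winner (k : K) : Role := if D.rep k = k then heads else tails

/-- The block that stands for `k`. -/
noncomputable def block (k : K) (r : Role) : K × Role :=
  (if r.IsLate then k else D.rep k, roleAt (D.winner k) r)

end ChainData

/-- The strength of the glues of the simulating system. -/
def glueStr {K : Type*} (g : ℕ × ℕ × Option K) : ℕ := labelStr g.1

/-- The cell `r` of the `5 × 4` block `q` of the plane. -/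
def blockCell (q : ℤ × ℤ) (r : Role) : ℤ × ℤ := (5 * q.1 + r.1.val, 4 * q.2 + r.2.val)

/-- The position of a cell of the plane in its block. -/
def roleOf (p : ℤ × ℤ) : Role := (Fin.ofNat 5 (p.1 % 5).toNat, Fin.ofNat 4 (p.2 % 4).toNat)

/-- The block of a cell of the plane. -/
def blockOf (p : ℤ × ℤ) : ℤ × ℤ := (p.1 / 5, p.2 / 4)

theorem blockOf_blockCell (q : ℤ × ℤ) (r : Role) : blockOf (blockCell q r) = q := by
  obtain ⟨x, y⟩ := q
  obtain ⟨i, j⟩ := r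
  simp only [blockOf, blockCell, Prod.mk.injEq]
  omega

theorem roleOf_blockCell (q : ℤ × ℤ) (r : Role) : roleOf (blockCell q r) = r := by
  obtain ⟨x, y⟩ := q
  obtain ⟨i, j⟩ := r
  simp only [roleOf, blockCell, Prod.mk.injEq, Fin.ext_iff, Fin.ofNat]
  omega

theorem blockCell_surjective (p : ℤ × ℤ) : blockCell (blockOf p) (roleOf p) = p := by
  obtain ⟨x, y⟩ := p
  simp only [roleOf, blockOf, blockCell, Prod.mk.injEq, Fin.ofNat]
  omega

theorem blockCell_inj {q q' : ℤ × ℤ} {r r' : Role} :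
    blockCell q r = blockCell q' r' ↔ q = q' ∧ r = r' := by
  constructor
  · intro h
    exact ⟨by simpa [blockOf_blockCell] using congrArg blockOf h,
      by simpa [roleOf_blockCell] using congrArg roleOf h⟩
  · rintro ⟨rfl, rfl⟩; rfl

namespace Assembly

theorem cell_blockReplace {T T' : Type*} (R : T → Fin 5 → Fin 4 → T') (A : Assembly T)
    (q : ℤ × ℤ) (r : Role) :
    (A.blockReplace R).cell (blockCell q r) = (A.cell q).map fun t => R t r.1 r.2 := by
  have h1 := blockOf_blockCell q r
  have h2 := roleOf_blockCell q r
  simp only [blockOf, roleOf] at h1 h2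
  simp only [blockReplace, Nat.cast_ofNat, h1]
  congr 1
  funext t
  obtain ⟨e1, e2⟩ := Prod.ext_iff.1 h2
  simp only at e1 e2
  rw [e1, e2]

/-- The assembly `B` with the contents of the block `q` replaced by `m`. -/
def fill {T : Type*} (B : Assembly T) (q : ℤ × ℤ) (m : Role → Option T) : Assembly T where
  cell p := if blockOf p = q then m (roleOf p) else B.cell p
  finite_cells := by
    refine (B.finite_cells.union (Set.finite_range (blockCell q))).subset ?_
    intro p hp
    by_cases h : blockOf p = q
    · exact Or.inr ⟨roleOf p, by rw [← h, blockCell_surjective]⟩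
    · left
      simpa [h] using hp

variable {T : Type*} (B : Assembly T) (q : ℤ × ℤ) (m : Role → Option T)

theorem cell_fill (r : Role) : (B.fill q m).cell (blockCell q r) = m r := by
  simp [fill, blockOf_blockCell, roleOf_blockCell]

theorem cell_fill_of_ne {q' : ℤ × ℤ} (h : q' ≠ q) (r : Role) :
    (B.fill q m).cell (blockCell q' r) = B.cell (blockCell q' r) := by
  simp [fill, blockOf_blockCell, h]

theorem ext_blockCell {A B : Assembly T} (h : ∀ q r, A.cell (blockCell q r) = B.cell (blockCell q r)) :
    A = B := by
  ext1
  funext p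
  rw [← blockCell_surjective p]
  exact h _ _

theorem fill_place {m m' : Role → Option T} {r : Role} {a : T} (h : m' r = some a)
    (h' : ∀ r', r' ≠ r → m' r' = m r') :
    (B.fill q m).place (blockCell q r) a = B.fill q m' := by
  refine ext_blockCell fun q' r' => ?_
  by_cases hc : blockCell q' r' = blockCell q r
  · rw [hc, cell_place_self, cell_fill, h]
  · rw [cell_place_of_ne _ _ hc]
    by_cases hq : q' = q
    · subst hq
      rw [cell_fill, cell_fill, h']
      rintro rfl; exact hc rfl
    · rw [cell_fill_of_ne _ _ _ hq, cell_fill_of_ne _ _ _ hq]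

theorem fill_none (h : ∀ r, B.cell (blockCell q r) = none) : B.fill q (fun _ => none) = B := by
  refine ext_blockCell fun q' r' => ?_
  by_cases hq : q' = q
  · subst hq; rw [cell_fill, h]
  · rw [cell_fill_of_ne _ _ _ hq]

theorem fill_blockReplace {T' : Type*} (R : T → Fin 5 → Fin 4 → T') (A : Assembly T) (t : T) :
    (A.blockReplace R).fill q (fun r => some (R t r.1 r.2)) = (A.place q t).blockReplace R := by
  refine ext_blockCell fun q' r' => ?_
  rw [cell_blockReplace]
  by_cases hq : q' = q
  · subst hq; rw [cell_fill, cell_place_self]; rfl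
  · rw [cell_fill_of_ne _ _ _ hq, cell_place_of_ne _ _ hq, cell_blockReplace]

end Assembly

theorem blockCell_add_vec (q : ℤ × ℤ) (r : Role) (d : Side) :
    blockCell q r + d.vec = match d with
      | .north => if h : r.2.val + 1 < 4 then blockCell q (r.1, ⟨r.2 + 1, h⟩)
          else blockCell (q + Side.north.vec) (r.1, 0)
      | .east => if h : r.1.val + 1 < 5 then blockCell q (⟨r.1 + 1, h⟩, r.2)
          else blockCell (q + Side.east.vec) (0, r.2)
      | .south => if 0 < r.2.val then blockCell q (r.1, ⟨r.2 - 1, by omega⟩)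
          else blockCell (q + Side.south.vec) (r.1, 3)
      | .west => if 0 < r.1.val then blockCell q (⟨r.1 - 1, by omega⟩, r.2)
          else blockCell (q + Side.west.vec) (4, r.2) := by
  obtain ⟨x, y⟩ := q
  obtain ⟨i, j⟩ := r
  have h3 : ((3 : Fin 4) : ℕ) = 3 := rfl
  have h4 : ((4 : Fin 5) : ℕ) = 4 := rfl
  cases d <;> dsimp only <;> split_ifs with h <;>
    simp only [blockCell, Side.vec, Prod.mk_add_mk, Prod.mk.injEq, Fin.val_zero, h3, h4] <;>
    omega

/-- The role of a tile at the cell `r` of a block. -/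
def RoleOK (r s : Role) : Prop := s = r ∨ r = contested ∧ (s = heads ∨ s = tails)

instance : DecidableRel RoleOK := fun r s => by unfold RoleOK; infer_instance

theorem roleOK_roleAt {z : Role} (hz : z = heads ∨ z = tails) (r : Role) :
    RoleOK r (roleAt z r) := by
  unfold RoleOK roleAt
  split_ifs with h
  · exact Or.inr ⟨h, hz⟩
  · exact Or.inl rfl

/-- Blocks interact vertically not at all, and horizontally with strength 2 only in the top row,
where the exit of one block meets the entry of the next. -/
theorem label_boundary : ∀ r s, RoleOK r s →
    (r.2 = 3 → label s .north = 0) ∧ (r.2 = 0 → label s .south = 0) ∧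
    (r.1 = 4 → r.2 ≠ 3 → labelStr (label s .east) ≤ 1) ∧
    (r.1 = 0 → r.2 ≠ 3 → labelStr (label s .west) ≤ 1) := by
  decide +kernel

theorem label_east_eq_entry : ∀ s : Role, label s .east = 20 → s = (4, 3) := by decide +kernel

theorem ChainData.winner_eq {K : Type*} (D : ChainData K) (k : K) :
    D.winner k = heads ∨ D.winner k = tails := by
  unfold ChainData.winner
  split_ifs <;> simp

end ATAM

/-! ### Growth is confined to the block at the east end -/

namespace ATAM

open Role Assembly

variable {T K : Type*}

/-- The occupied cells of `A` are those of the row of `q` from `x₀` up to the cell before `q`, with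
the tile types `a` in the first and `s` in the last of them. -/
structure IsRow (A : Assembly T) (x₀ : ℤ) (q : ℤ × ℤ) (a s : T) : Prop where
  cell_ne : ∀ p, A.cell p ≠ none ↔ p.2 = q.2 ∧ x₀ ≤ p.1 ∧ p.1 < q.1
  first : A.cell (x₀, q.2) = some a
  last : A.cell (q.1 - 1, q.2) = some s

namespace ChainData

variable (D : ChainData K)

/-- The block mapping of the simulation. -/
noncomputable def blocks (e : T → K) (t : T) (i : Fin 5) (j : Fin 4) : K × Role :=
  D.block (e t) (i, j)

/-- The total strength of the bonds of a tile of type `b` at the cell `r` of a block with the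
contents `m`, to the east of the complete block that stands for `s`. -/
noncomputable def localWeight (m : Role → Option (K × Role)) (s : K) (r : Role) (b : K × Role) : ℕ :=
  ∑ d : Side, bondWith D.glue glueStr b d (look m (fun j => (s, (4, j))) r d)

/-- The tile system has the tile types and glues of the simulating system. -/
structure IsSimulator (Γs : TileSystem (K × Role) (ℕ × ℕ × Option K)) : Prop where
  glue_eq : Γs.glue = D.glue
  str_eq : Γs.str = glueStr
  temperature_eq : Γs.temperature = 2

variable {D}

theorem bondWith_le (b : K × Role) (d : Side) (a : K × Role) :
    bondWith D.glue glueStr b d (some a) ≤ labelStr (label a.2 d.opp) := by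
  rw [bondWith_some]
  split_ifs with h
  · rw [h]; rfl
  · exact Nat.zero_le _

theorem roleOK_block (k : K) (r : Role) : RoleOK r (D.block k r).2 :=
  roleOK_roleAt (D.winner_eq k) r

theorem roleOK_cell_blockReplace {e : T → K} {A : Assembly T} {q : ℤ × ℤ} {r : Role} {b : K × Role}
    (h : (A.blockReplace (D.blocks e)).cell (blockCell q r) = some b) : RoleOK r b.2 := by
  rw [cell_blockReplace] at h
  obtain ⟨t, -, rfl⟩ := Option.map_eq_some_iff.1 h
  exact roleOK_block _ _

variable {e : T → K} {A : Assembly T} {x₀ : ℤ} {q : ℤ × ℤ} {a s : T}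

theorem cell_neighbor (hA : IsRow A x₀ q a s) (m : Role → Option (K × Role)) (r : Role) (d : Side) :
    ((A.blockReplace (D.blocks e)).fill q m).cell (blockCell q r + d.vec) =
      look m (fun j => (e s, (4, j))) r d := by
  have hnone : ∀ p : ℤ × ℤ, ¬(p.2 = q.2 ∧ x₀ ≤ p.1 ∧ p.1 < q.1) → A.cell p = none := fun p hp => by
    by_contra h; exact hp ((hA.cell_ne p).1 h)
  rw [blockCell_add_vec]
  cases d <;> dsimp only [look] <;> split_ifs with h
  · rw [cell_fill]
  · rw [cell_fill_of_ne _ _ _ (by simp [Side.vec]), cell_blockReplace,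
      hnone _ (by simp [Side.vec])]
    rfl
  · rw [cell_fill]
  · rw [cell_fill_of_ne _ _ _ (by simp [Side.vec]), cell_blockReplace,
      hnone _ (by simp [Side.vec])]
    rfl
  · rw [cell_fill]
  · rw [cell_fill_of_ne _ _ _ (by simp [Side.vec]), cell_blockReplace,
      hnone _ (by simp [Side.vec])]
    rfl
  · rw [cell_fill]
  · rw [cell_fill_of_ne _ _ _ (by simp [Side.vec]), cell_blockReplace]
    have : q + Side.west.vec = (q.1 - 1, q.2) := by
      ext <;> simp [Side.vec]; ring
    rw [this, hA.last]
    simp [blocks, block, IsLate, roleAt]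

/-- A cell of another empty block sees occupied cells across at most one vertical block boundary,
and such a bond has strength at most 1 outside the top row. In the top row, `hexit` excludes a bond
to an exit of the incomplete block, and `hfirst` excludes a bond to the entry of the first block. -/
theorem attachWeight_outside (hA : IsRow A x₀ q a s)
    (hfirst : ∀ k, D.next k ≠ some (D.rep (e a))) {m : Role → Option (K × Role)}
    (hm : ∀ r b, m r = some b → RoleOK r b.2) (hexit : m (4, 3) = none) {q' : ℤ × ℤ} (hq : q' ≠ q)
    {r : Role}
    (hnone : ((A.blockReplace (D.blocks e)).fill q m).cell (blockCell q' r) = none) (b : K × Role) :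
    ((A.blockReplace (D.blocks e)).fill q m).attachWeight D.glue glueStr (blockCell q' r) b < 2 := by
  set B := (A.blockReplace (D.blocks e)).fill q m with hB
  have hrole : ∀ q r b, B.cell (blockCell q r) = some b → RoleOK r b.2 := by
    intro q₁ r b h
    by_cases hq₁ : q₁ = q
    · subst hq₁; rw [hB, cell_fill] at h; exact hm r b h
    · rw [hB, cell_fill_of_ne _ _ _ hq₁] at h; exact roleOK_cell_blockReplace h
  have hAq : A.cell q' = none := by
    rw [hB, cell_fill_of_ne _ _ _ hq, cell_blockReplace] at hnone
    simpa using hnone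
  have hB' : ∀ r, B.cell (blockCell q' r) = none := by
    intro r
    rw [hB, cell_fill_of_ne _ _ _ hq, cell_blockReplace, hAq]; rfl
  have hrow := hA.cell_ne
  have hAq' : ¬(q'.2 = q.2 ∧ x₀ ≤ q'.1 ∧ q'.1 < q.1) := fun h => (hrow q').2 h hAq
  have hlast := (hrow (q.1 - 1, q.2)).1 (by rw [hA.last]; simp)
  simp only at hlast
  have hsum : ∀ f : Side → ℕ, ∑ d : Side, f d = f .north + f .east + f .south + f .west := by
    intro f
    have : (Finset.univ : Finset Side) = {.north, .east, .south, .west} := rfl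
    rw [this, Finset.sum_insert (by decide), Finset.sum_insert (by decide),
      Finset.sum_insert (by decide), Finset.sum_singleton]
    ring
  rw [attachWeight, hsum]
  have hN : bondWith D.glue glueStr b .north (B.cell (blockCell q' r + Side.north.vec)) = 0 := by
    rw [blockCell_add_vec]
    dsimp only
    split_ifs with h
    · rw [hB']; rfl
    · rcases hc : B.cell (blockCell (q' + Side.north.vec) (r.1, 0)) with _ | c
      · rfl
      · have h1 := bondWith_le (D := D) b .north c
        have h2 := (label_boundary _ _ (hrole _ _ _ hc)).2.1 rfl
        simp only [Side.opp, h2] at h1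
        exact Nat.le_zero.1 h1
  have hS : bondWith D.glue glueStr b .south (B.cell (blockCell q' r + Side.south.vec)) = 0 := by
    rw [blockCell_add_vec]
    dsimp only
    split_ifs with h
    · rw [hB']; rfl
    · rcases hc : B.cell (blockCell (q' + Side.south.vec) (r.1, 3)) with _ | c
      · rfl
      · have h1 := bondWith_le (D := D) b .south c
        have h2 := (label_boundary _ _ (hrole _ _ _ hc)).1 rfl
        simp only [Side.opp, h2] at h1
        exact Nat.le_zero.1 h1
  have hE : (r.1.val + 1 < 5 →
        bondWith D.glue glueStr b .east (B.cell (blockCell q' r + Side.east.vec)) = 0) ∧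
      bondWith D.glue glueStr b .east (B.cell (blockCell q' r + Side.east.vec)) ≤ 1 := by
    rw [blockCell_add_vec]
    dsimp only
    split_ifs with h
    · rw [hB']; exact ⟨fun _ => rfl, Nat.zero_le _⟩
    · refine ⟨fun h' => absurd h' h, ?_⟩
      rcases hc : B.cell (blockCell (q' + Side.east.vec) (0, r.2)) with _ | c
      · exact Nat.zero_le _
      · by_cases hr : r.2 = 3
        · have hne : q' + Side.east.vec ≠ q := by
            intro hqq
            apply hAq'
            rw [← hqq] at hlast ⊢
            simp [Side.vec] at hlast ⊢
            omega
          rw [hB, cell_fill_of_ne _ _ _ hne, cell_blockReplace] at hc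
          obtain ⟨t, ht, rfl⟩ := Option.map_eq_some_iff.1 hc
          have h1 := (hrow _).1 (by rw [ht]; simp : A.cell (q' + Side.east.vec) ≠ none)
          have h2 : q' + Side.east.vec = (x₀, q.2) := by
            simp [Side.vec] at h1 ⊢
            ext
            · simp; omega
            · simp; omega
          rw [h2, hA.first] at ht
          obtain rfl := Option.some.inj ht
          rw [bondWith_some, if_neg]
          · exact Nat.zero_le _
          · intro hg
            rw [hr] at hg
            have hl : label b.2 .east = 20 := congrArg Prod.fst hg
            have hb := label_east_eq_entry _ hl
            obtain ⟨k, rb⟩ := b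
            simp only at hb
            subst hb
            have := congrArg Prod.snd (congrArg Prod.snd hg)
            simp [glue, glueData, blocks, block, roleAt, IsLate, Side.opp] at this
            exact hfirst k this
        · refine (bondWith_le (D := D) b .east c).trans ?_
          exact (label_boundary _ _ (hrole _ _ _ hc)).2.2.2 rfl hr
  have hW : (0 < r.1.val →
        bondWith D.glue glueStr b .west (B.cell (blockCell q' r + Side.west.vec)) = 0) ∧
      bondWith D.glue glueStr b .west (B.cell (blockCell q' r + Side.west.vec)) ≤ 1 := by
    rw [blockCell_add_vec]
    dsimp only
    split_ifs with h
    · rw [hB']; exact ⟨fun _ => rfl, Nat.zero_le _⟩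
    · refine ⟨fun h' => absurd h' h, ?_⟩
      rcases hc : B.cell (blockCell (q' + Side.west.vec) (4, r.2)) with _ | c
      · exact Nat.zero_le _
      · by_cases hr : r.2 = 3
        · exfalso
          by_cases hqq : q' + Side.west.vec = q
          · rw [hqq, hr, hB, cell_fill, hexit] at hc
            simp at hc
          · rw [hB, cell_fill_of_ne _ _ _ hqq, cell_blockReplace] at hc
            obtain ⟨t, ht, rfl⟩ := Option.map_eq_some_iff.1 hc
            have h1 := (hrow _).1 (by rw [ht]; simp : A.cell (q' + Side.west.vec) ≠ none)
            simp [Side.vec] at h1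
            exact hq (Prod.ext (by omega) h1.1)
        · refine (bondWith_le (D := D) b .west c).trans ?_
          exact (label_boundary _ _ (hrole _ _ _ hc)).2.2.1 rfl hr
  -- A block has five columns, so no cell lies on both its east and its west boundary.
  by_cases hr : r.1.val + 1 < 5
  · have := hE.1 hr; omega
  · have := hW.1 (by omega); omega

/-- Reduces the frontier of the whole assembly to the twenty cells of one block. -/
theorem mem_frontier_fill_iff {Γs : TileSystem (K × Role) (ℕ × ℕ × Option K)}
    (hΓ : D.IsSimulator Γs) (hA : IsRow A x₀ q a s)
    (hfirst : ∀ k, D.next k ≠ some (D.rep (e a))) {m : Role → Option (K × Role)}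
    (hm : ∀ r b, m r = some b → RoleOK r b.2) (hexit : m (4, 3) = none)
    (hprod : Γs.Producible ((A.blockReplace (D.blocks e)).fill q m)) {p : ℤ × ℤ} {b : K × Role} :
    (p, b) ∈ Γs.frontier ((A.blockReplace (D.blocks e)).fill q m) ↔
      ∃ r, p = blockCell q r ∧ m r = none ∧ 2 ≤ D.localWeight m (e s) r b := by
  rw [hprod.mem_frontier_iff, hΓ.glue_eq, hΓ.str_eq, hΓ.temperature_eq]
  have hloc : ∀ r, ((A.blockReplace (D.blocks e)).fill q m).attachWeight D.glue glueStr
      (blockCell q r) b = D.localWeight m (e s) r b := by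
    intro r
    unfold attachWeight localWeight
    simp only [cell_neighbor hA]
  constructor
  · rintro ⟨h1, h2⟩
    rw [← blockCell_surjective p] at h1 h2
    by_cases hq : blockOf p = q
    · rw [hq] at h1 h2
      rw [cell_fill] at h1
      rw [hloc] at h2
      exact ⟨roleOf p, by rw [← hq, blockCell_surjective], h1, h2⟩
    · exact absurd h2 (not_le.2 (attachWeight_outside hA hfirst hm hexit hq h1 b))
  · rintro ⟨r, rfl, h1, h2⟩
    rw [cell_fill, hloc]
    exact ⟨h1, h2⟩

end ChainData

end ATAM

set_option linter.unusedSimpArgs false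

/-! ### Possible attachments at each stage of a block -/

namespace ATAM

open Role Assembly

theorem Side.sum_eq {M : Type*} [AddCommMonoid M] (f : Side → M) :
    ∑ d : Side, f d = f .north + (f .east + (f .south + f .west)) := by
  have : (Finset.univ : Finset Side) = {.north, .east, .south, .west} := rfl
  rw [this, Finset.sum_insert (by decide), Finset.sum_insert (by decide),
    Finset.sum_insert (by decide), Finset.sum_singleton]

theorem look_map {α β : Type*} (f : α → β) (m : Role → Option α) (w : Fin 4 → α) (r : Role)
    (d : Side) : look (fun r => (m r).map f) (fun j => f (w j)) r d = (look m w r d).map f := by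
  cases d <;> simp only [look] <;> split_ifs <;> rfl

/-- The contents of a block that stands for `t` at the stage `S`, where `ρ` is the representative
of `t`, and `z` the role of the tile at the contested cell. -/
def Stage.contents {K : Type*} (S : Stage) (ρ t : K) (z r : Role) : Option (K × Role) :=
  if S.Filled r then some (if r.IsLate then t else ρ, roleAt z r) else none

theorem Stage.contents_map {K : Type*} (S : Stage) (ρ t : K) (z r : Role) :
    (S.contents ρ t z r).map Prod.snd = S.roles z r := by
  unfold contents roles
  split_ifs <;> rfl

namespace ChainData

variable {K : Type*} {D : ChainData K}

/-- Equal glues have equal labels. The bound no longer mentions `K` or `D`, so attachments excluded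
by labels alone can be ruled out by a finite computation over cells and roles. -/
theorem localWeight_le_bound (S : Stage) (ρ t s : K) (z r : Role) (b : K × Role) :
    D.localWeight (S.contents ρ t z) s r b ≤ S.bound z r b.2 := by
  have key : ∀ d, bondWith D.glue glueStr b d
      (look (S.contents ρ t z) (fun j => (s, (4, j))) r d) ≤
      match look (S.roles z) (fun j => (4, j)) r d with
      | some a => if label b.2 d = label a d.opp then labelStr (label b.2 d) else 0
      | none => 0 := by
    intro d
    have h := look_map Prod.snd (S.contents ρ t z) (fun j => (s, ((4 : Fin 5), j))) r d
    simp only [Stage.contents_map] at h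
    rw [show S.roles z = fun r => S.roles z r from rfl, h]
    rcases look (S.contents ρ t z) (fun j => (s, (4, j))) r d with _ | a
    · exact Nat.zero_le _
    · simp only [Option.map_some, bondWith_some]
      split_ifs with h1 h2 h2
      · exact le_rfl
      · exact absurd (congrArg Prod.fst h1) h2
      · exact Nat.zero_le _
      · exact le_rfl
  rw [localWeight, Side.sum_eq]
  simp only [Stage.bound, List.map_cons, List.map_nil, List.sum_cons, List.sum_nil, add_zero]
  exact add_le_add (key _) (add_le_add (key _) (add_le_add (key _) (key _)))

theorem mem_of_allows {S : Stage} {z : Role} {l : List (Role × Role)} (h : S.Allows z l)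
    {ρ t s : K} {r : Role} {b : K × Role} (hr : S.contents ρ t z r = none)
    (hw : 2 ≤ D.localWeight (S.contents ρ t z) s r b) : (r, b.2) ∈ l := by
  refine (of_decide_eq_true h) r b.2 ?_ (hw.trans (localWeight_le_bound S ρ t s z r b))
  unfold Stage.contents at hr
  by_contra hc
  simp [hc] at hr

open Classical in
theorem bondWith_glue (b a : K × Role) (d : Side) :
    bondWith D.glue glueStr b d (some a) =
      if label b.2 d = label a.2 d.opp then
        if D.glueData b d = D.glueData a d.opp then labelStr (label b.2 d) else 0
      else 0 := by
  rw [bondWith_some]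
  by_cases h1 : label b.2 d = label a.2 d.opp <;>
    by_cases h2 : D.glueData b d = D.glueData a d.opp <;> simp [glue, h1, h2, glueStr]

variable (D) in
/-- The possible attachments to a block at the stage `S`, to the east of the complete block that
stands for `s`. -/
def localFrontier (S : Stage) (ρ t s : K) (z : Role) : Set (Role × (K × Role)) :=
  {x | S.contents ρ t z x.1 = none ∧ 2 ≤ D.localWeight (S.contents ρ t z) s x.1 x.2}

/-- Divides the work: labels leave a short list `l` of candidates, decided by computation, and the
glue data are examined only for these. -/
theorem localFrontier_eq {S : Stage} {z : Role} {l : List (Role × Role)} (h : S.Allows z l)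
    (hl : ∀ x ∈ l, S.Filled x.1 = false) {ρ t s : K} {F : Set (Role × (K × Role))}
    (hF : ∀ x ∈ F, (x.1, x.2.2) ∈ l)
    (hw : ∀ x ∈ l, ∀ k, 2 ≤ D.localWeight (S.contents ρ t z) s x.1 (k, x.2) ↔
      (x.1, (k, x.2)) ∈ F) :
    D.localFrontier S ρ t s z = F := by
  ext ⟨r, k, σ⟩
  constructor
  · rintro ⟨h1, h2⟩
    exact (hw _ (mem_of_allows h h1 h2) k).1 h2
  · intro hx
    have := hF _ hx
    refine ⟨?_, (hw _ this k).2 hx⟩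
    unfold Stage.contents
    rw [hl _ this]
    rfl

end ChainData

/-- The cells of the path before the coin flip. -/
def Role.earlyCell (n : ℕ) : Role :=
  ([(0, 3), (1, 3), (2, 3), (3, 3), (3, 2), (3, 1), (2, 1), (2, 2), (1, 2)] : List Role).getD n
    (0, 0)

/-- The cells of the path after the coin flip. -/
def Role.lateCell (n : ℕ) : Role :=
  ([(0, 0), (1, 0), (2, 0), (3, 0), (4, 0), (4, 1), (4, 2), (4, 3)] : List Role).getD n (0, 0)

namespace Stage

/-- The stages before the coin flip. -/
abbrev start (n : ℕ) : Stage := ⟨n, false, false, false, 0⟩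

/-- The stages after the coin flip. -/
abbrev final (n : ℕ) : Stage := ⟨9, true, true, true, n⟩

theorem allows_start : ∀ n < 9, (start n).Allows heads [(earlyCell n, earlyCell n)] = true := by
  decide +kernel

theorem allows_final_heads : ∀ n < 8, (final n).Allows heads [(lateCell n, lateCell n)] = true := by
  decide +kernel

theorem allows_final_tails : ∀ n < 8, (final n).Allows tails [(lateCell n, lateCell n)] = true := by
  decide +kernel

theorem filled_earlyCell : ∀ n < 9, (start n).Filled (earlyCell n) = false := by decide +kernel

theorem filled_lateCell : ∀ n < 8, (final n).Filled (lateCell n) = false := by decide +kernel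

end Stage

namespace ChainData

variable {K : Type*} {D : ChainData K} {ρ t s : K}

open Stage

theorem localFrontier_start (hs : D.next s = some ρ) {n : ℕ} (hn : n < 9) :
    D.localFrontier (start n) ρ t s heads = {(earlyCell n, (ρ, earlyCell n))} := by
  classical
  refine localFrontier_eq (allows_start n hn) (by simpa using filled_earlyCell n hn)
    ?_ ?_
  · simp
  simp only [List.mem_singleton, forall_eq, Set.mem_singleton_iff]
  intro k
  interval_cases n <;>
  simp [localWeight, Side.sum_eq, look, contents, Filled, bondWith_glue, bondWith_none, glueData,
    label, labelTable, sideIndex, rank, IsLate, roleAt, Side.opp, labelStr, earlyCell, hs] <;>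
  split_ifs <;> simp_all

theorem localFrontier_start_of_none (hs : D.next s = none) :
    D.localFrontier (start 0) ρ t s heads = ∅ := by
  classical
  refine localFrontier_eq (allows_start 0 (by norm_num)) (by simpa using filled_earlyCell 0 (by norm_num))
    ?_ ?_
  · simp
  simp only [List.mem_singleton, forall_eq]
  intro k
  simp [localWeight, Side.sum_eq, look, contents, Filled, bondWith_glue, bondWith_none, glueData,
    label, labelTable, sideIndex, rank, IsLate, roleAt, Side.opp, labelStr, earlyCell, hs]

theorem localFrontier_trigger :
    D.localFrontier (start 9) ρ t s heads = {(heads, (ρ, heads)), (tails, (ρ, tails))} := by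
  classical
  refine localFrontier_eq (l := [(heads, heads), (tails, tails)]) (by decide +kernel)
    (by decide +kernel) (by simp) ?_
  simp only [List.forall_mem_cons, List.not_mem_nil, false_imp_iff, implies_true, and_true]
  constructor <;> intro k <;>
  simp [localWeight, Side.sum_eq, look, contents, Filled, bondWith_glue, bondWith_none, glueData,
    label, labelTable, sideIndex, rank, IsLate, roleAt, Side.opp, labelStr] <;>
  split_ifs <;> simp_all

/-- At the contested cell `tails` binds to `heads` above it, if the class of `ρ` is paired, and to
the block on the west. Both possible attachments use the same tile type, which makes their
probabilities independent of the concentrations. -/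
theorem localFrontier_heads (hs : D.next s = some ρ) :
    D.localFrontier ⟨9, true, false, false, 0⟩ ρ t s heads =
      {x | x = (tails, (ρ, tails)) ∨ x = (contested, (ρ, tails)) ∧ D.Paired ρ} := by
  classical
  refine localFrontier_eq (l := [(tails, tails), (contested, tails)]) (by decide +kernel)
    (by decide +kernel) (by rintro x (rfl | ⟨rfl, -⟩) <;> simp) ?_
  simp only [List.forall_mem_cons, List.not_mem_nil, false_imp_iff, implies_true, and_true]
  constructor <;> intro k <;>
  simp [localWeight, Side.sum_eq, look, contents, Filled, bondWith_glue, bondWith_none, glueData,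
    label, labelTable, sideIndex, rank, IsLate, roleAt, Side.opp, labelStr, hs] <;>
  split_ifs <;> simp_all

theorem localFrontier_tails (hs : D.next s = some ρ) :
    D.localFrontier ⟨9, false, true, false, 0⟩ ρ t s heads =
      {(contested, (ρ, heads)), (heads, (ρ, heads))} := by
  classical
  refine localFrontier_eq (l := [(contested, heads), (heads, heads)]) (by decide +kernel)
    (by decide +kernel) (by simp) ?_
  simp only [List.forall_mem_cons, List.not_mem_nil, false_imp_iff, implies_true, and_true]
  constructor <;> intro k <;>
  simp [localWeight, Side.sum_eq, look, contents, Filled, bondWith_glue, bondWith_none, glueData,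
    label, labelTable, sideIndex, rank, IsLate, roleAt, Side.opp, labelStr, hs] <;>
  split_ifs <;> simp_all

theorem localFrontier_both (hs : D.next s = some ρ) :
    D.localFrontier ⟨9, true, true, false, 0⟩ ρ t s heads =
      {x | x = (contested, (ρ, heads)) ∨ x = (contested, (ρ, tails)) ∧ D.Paired ρ} := by
  classical
  refine localFrontier_eq (l := [(contested, heads), (contested, tails)]) (by decide +kernel)
    (by decide +kernel) (by rintro x (rfl | ⟨rfl, -⟩) <;> simp) ?_
  simp only [List.forall_mem_cons, List.not_mem_nil, false_imp_iff, implies_true, and_true]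
  constructor <;> intro k <;>
  simp [localWeight, Side.sum_eq, look, contents, Filled, bondWith_glue, bondWith_none, glueData,
    label, labelTable, sideIndex, rank, IsLate, roleAt, Side.opp, labelStr, hs] <;>
  split_ifs <;> simp_all

/-- The first tile of the late path needs only the winner above it and the block on the west, so it
can overtake the missing tile at `(0, 2)`. -/
theorem localFrontier_tails_heads (hρ : D.rep ρ = ρ) :
    D.localFrontier ⟨9, false, true, true, 0⟩ ρ t s heads =
      {(heads, (ρ, heads)), ((0, 0), (ρ, (0, 0)))} := by
  classical
  refine localFrontier_eq (l := [(heads, heads), ((0, 0), (0, 0))]) (by decide +kernel)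
    (by decide +kernel) (by simp) ?_
  simp only [List.forall_mem_cons, List.not_mem_nil, false_imp_iff, implies_true, and_true]
  constructor <;> intro k <;>
  simp [localWeight, Side.sum_eq, look, contents, Filled, bondWith_glue, bondWith_none, glueData,
    label, labelTable, sideIndex, rank, IsLate, roleAt, Side.opp, labelStr] <;>
  split_ifs <;> simp_all
  all_goals grind

/-- Here `huniq` matters: the south glue of the winner `tails` accepts every non-representative in
the class of `ρ`, and only `t` is one. -/
theorem localFrontier_heads_tails (ht : D.rep t = ρ) (hne : t ≠ ρ)
    (huniq : ∀ k, D.rep k = ρ → k = ρ ∨ k = t) :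
    D.localFrontier ⟨9, true, false, true, 0⟩ ρ t s tails =
      {(tails, (ρ, tails)), ((0, 0), (t, (0, 0)))} := by
  classical
  refine localFrontier_eq (l := [(tails, tails), ((0, 0), (0, 0))]) (by decide +kernel)
    (by decide +kernel) (by simp) ?_
  simp only [List.forall_mem_cons, List.not_mem_nil, false_imp_iff, implies_true, and_true]
  constructor <;> intro k <;>
  simp [localWeight, Side.sum_eq, look, contents, Filled, bondWith_glue, bondWith_none, glueData,
    label, labelTable, sideIndex, rank, IsLate, roleAt, Side.opp, labelStr] <;>
  split_ifs <;> simp_all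
  all_goals grind

/-- The late path stops after one tile, since `(1, 0)` needs a bond to `tails` above it. -/
theorem localFrontier_heads_tails_late :
    D.localFrontier ⟨9, true, false, true, 1⟩ ρ t s tails = {(tails, (ρ, tails))} := by
  classical
  refine localFrontier_eq (l := [(tails, tails)]) (by decide +kernel)
    (by decide +kernel) (by simp) ?_
  simp only [List.forall_mem_cons, List.not_mem_nil, false_imp_iff, implies_true, and_true]
  intro k
  simp [localWeight, Side.sum_eq, look, contents, Filled, bondWith_glue, bondWith_none, glueData,
    label, labelTable, sideIndex, rank, IsLate, roleAt, Side.opp, labelStr]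
  split_ifs <;> simp_all

theorem localFrontier_final_heads (hρ : D.rep ρ = ρ) {n : ℕ} (hn : n < 8) :
    D.localFrontier (final n) ρ ρ s heads = {(lateCell n, (ρ, lateCell n))} := by
  classical
  refine localFrontier_eq (allows_final_heads n hn) (by simpa using filled_lateCell n hn)
    ?_ ?_
  · simp
  simp only [List.mem_singleton, forall_eq, Set.mem_singleton_iff]
  intro k
  interval_cases n <;>
  simp [localWeight, Side.sum_eq, look, contents, Filled, bondWith_glue, bondWith_none, glueData,
    label, labelTable, sideIndex, rank, IsLate, roleAt, Side.opp, labelStr, lateCell] <;>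
  split_ifs <;> simp_all
  all_goals grind

theorem localFrontier_final_tails (ht : D.rep t = ρ)
    (hne : t ≠ ρ) (huniq : ∀ k, D.rep k = ρ → k = ρ ∨ k = t) {n : ℕ} (hn : n < 8) :
    D.localFrontier (final n) ρ t s tails = {(lateCell n, (t, lateCell n))} := by
  classical
  refine localFrontier_eq (allows_final_tails n hn) (by simpa using filled_lateCell n hn)
    ?_ ?_
  · simp
  simp only [List.mem_singleton, forall_eq, Set.mem_singleton_iff]
  intro k
  interval_cases n <;>
  simp [localWeight, Side.sum_eq, look, contents, Filled, bondWith_glue, bondWith_none, glueData,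
    label, labelTable, sideIndex, rank, IsLate, roleAt, Side.opp, labelStr, lateCell] <;>
  split_ifs <;> simp_all
  all_goals grind

end ChainData
end ATAM

/-! ### Growth and hitting probabilities of an assembly with an incomplete block -/

namespace ATAM

open Role Assembly

namespace Stage

/-- Only the late path records the chosen type. Before it starts, one assembly can therefore be read
as an incomplete block of `ρ` or of its partner, as the two outcomes of the coin require. -/
theorem contents_of_late_eq_zero {K : Type*} {S : Stage} (hS : S.late = 0) (ρ t t' : K) (z : Role) :
    S.contents ρ t z = S.contents ρ t' z := by
  funext r
  have hl : r.IsLate = true → S.Filled r = false := by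
    intro hr
    have hne : r ≠ heads ∧ r ≠ tails ∧ r ≠ contested := by
      refine ⟨?_, ?_, ?_⟩ <;> rintro rfl <;> exact absurd hr (by decide)
    simp [Filled, hne.1, hne.2.1, hne.2.2, hr, hS]
  unfold contents
  by_cases hr : r.IsLate = true
  · simp [hl hr]
  · simp [hr]

theorem contents_start_zero {K : Type*} (ρ t : K) (z : Role) :
    (start 0).contents ρ t z = fun _ => none := by
  funext r
  have : (start 0).Filled r = false := by revert r; decide +kernel
  simp [contents, this]

theorem filled_start_succ : ∀ n < 9, (start (n + 1)).Filled (earlyCell n) = true ∧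
    ∀ r, r ≠ earlyCell n → (start (n + 1)).Filled r = (start n).Filled r := by decide +kernel

theorem filled_final_succ : ∀ n < 8, (final (n + 1)).Filled (lateCell n) = true ∧
    ∀ r, r ≠ lateCell n → (final (n + 1)).Filled r = (final n).Filled r := by decide +kernel

theorem filled_exit : (∀ n ≤ 9, (start n).Filled (4, 3) = false) ∧
    ∀ n < 8, (final n).Filled (4, 3) = false := by decide +kernel

theorem isLate_earlyCell : ∀ n < 9, (earlyCell n).IsLate = false ∧ earlyCell n ≠ contested := by
  decide +kernel

theorem isLate_lateCell : ∀ n < 8, (lateCell n).IsLate = true ∧ lateCell n ≠ contested := by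
  decide +kernel

theorem filled_final : ∀ r, (final 8).Filled r = true := by decide +kernel

end Stage

namespace ChainData

variable {T K : Type*}

/-- The row `A` ends with a tile of type `s` to the west of `q`, and no tile of the simulating
system can be attached at its other end. -/
structure IsGrowing (D : ChainData K) (Γs : TileSystem (K × Role) (ℕ × ℕ × Option K)) (e : T → K)
    (A : Assembly T) (q : ℤ × ℤ) (s : T) : Prop where
  sim : D.IsSimulator Γs
  row : ∃ x₀ a, IsRow A x₀ q a s ∧ ∀ k, D.next k ≠ some (D.rep (e a))

/-- The assembly that stands for `A`, with an incomplete block at `q`. -/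
noncomputable def partialBlock (D : ChainData K) (e : T → K) (A : Assembly T) (q : ℤ × ℤ) (S : Stage)
    (ρ t : K) (z : Role) : Assembly (K × Role) :=
  (A.blockReplace (D.blocks e)).fill q (S.contents ρ t z)

variable {D : ChainData K} {Γs : TileSystem (K × Role) (ℕ × ℕ × Option K)} {e : T → K}
  {A : Assembly T} {q : ℤ × ℤ} {s : T} {S S' : Stage} {ρ t : K} {z z' : Role}

open Stage

theorem partialBlock_start_zero (h : D.IsGrowing Γs e A q s) :
    D.partialBlock e A q (start 0) ρ t z = A.blockReplace (D.blocks e) := by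
  obtain ⟨x₀, a, hA, -⟩ := h.row
  rw [partialBlock, contents_start_zero, fill_none]
  intro r
  rw [cell_blockReplace]
  have : A.cell q = none := by
    by_contra hc
    exact lt_irrefl _ ((hA.cell_ne q).1 hc).2.2
  rw [this]; rfl

theorem partialBlock_final (u : T) :
    D.partialBlock e A q (final 8) (D.rep (e u)) (e u) (D.winner (e u)) =
      (A.place q u).blockReplace (D.blocks e) := by
  rw [← fill_blockReplace, partialBlock]
  congr 1
  funext r
  simp [contents, filled_final, blocks, block]

theorem partialBlock_congr {t' : K} (hS : S.late = 0) :
    D.partialBlock e A q S ρ t z = D.partialBlock e A q S ρ t' z := by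
  rw [partialBlock, partialBlock, contents_of_late_eq_zero hS ρ t t']

theorem frontier_partialBlock (h : D.IsGrowing Γs e A q s) (hz : z = heads ∨ z = tails)
    (hexit : S.Filled (4, 3) = false) (hp : Γs.Producible (D.partialBlock e A q S ρ t z)) :
    Γs.frontier (D.partialBlock e A q S ρ t z) =
      (fun x => (blockCell q x.1, x.2)) '' D.localFrontier S ρ t (e s) z := by
  obtain ⟨x₀, a, hA, hfirst⟩ := h.row
  ext ⟨p, b⟩
  have hm : ∀ r b, S.contents ρ t z r = some b → RoleOK r b.2 := by
    intro r b hb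
    unfold contents at hb
    split_ifs at hb <;>
    · obtain rfl := Option.some.inj hb
      exact roleOK_roleAt hz r
  have he : S.contents ρ t z (4, 3) = none := by simp [contents, hexit]
  rw [partialBlock, mem_frontier_fill_iff h.sim hA hfirst hm he hp]
  constructor
  · rintro ⟨r, rfl, h1, h2⟩
    exact ⟨(r, b), ⟨h1, h2⟩, rfl⟩
  · rintro ⟨⟨r, b'⟩, ⟨h1, h2⟩, heq⟩
    obtain ⟨h3, h4⟩ := Prod.mk.inj heq
    simp only at h3 h4 h2 h1
    subst h3 h4
    exact ⟨r, rfl, h1, h2⟩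

/-- The role `z` of the winner is immaterial while the contested cell is empty, so it may be changed
by the very attachment that fills this cell. -/
theorem place_partialBlock {r : Role} (hr : S'.Filled r = true)
    (hf : ∀ r', r' ≠ r → S'.Filled r' = S.Filled r') (hz : z = z' ∨ r = contested) :
    (D.partialBlock e A q S ρ t z).place (blockCell q r) (if r.IsLate then t else ρ, roleAt z' r) =
      D.partialBlock e A q S' ρ t z' := by
  refine fill_place _ _ ?_ ?_
  · simp [contents, hr]
  · intro r' hr'
    unfold contents
    rw [hf r' hr']
    rcases hz with rfl | rfl
    · rfl
    · simp [roleAt, hr']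

theorem producible_place (h : D.IsGrowing Γs e A q s) (hz : z = heads ∨ z = tails)
    (hexit : S.Filled (4, 3) = false) (hp : Γs.Producible (D.partialBlock e A q S ρ t z)) {r : Role}
    {b : K × Role} (hb : (r, b) ∈ D.localFrontier S ρ t (e s) z) :
    Γs.Producible ((D.partialBlock e A q S ρ t z).place (blockCell q r) b) := by
  refine hp.attach ?_
  rw [frontier_partialBlock h hz hexit hp]
  exact ⟨(r, b), hb, rfl⟩

section Probability

variable [Fintype K] {C : Concentration (K × Role)} {X : Assembly (K × Role)}

theorem hit_forced (h : D.IsGrowing Γs e A q s) (hX : Γs.frontier X = ∅)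
    (hz : z = heads ∨ z = tails)
    (hexit : S.Filled (4, 3) = false) (hp : Γs.Producible (D.partialBlock e A q S ρ t z)) {r : Role}
    {b : K × Role} (hb : D.localFrontier S ρ t (e s) z = {(r, b)}) :
    Γs.hit C X (D.partialBlock e A q S ρ t z) =
      Γs.hit C X ((D.partialBlock e A q S ρ t z).place (blockCell q r) b) := by
  have hF := frontier_partialBlock h hz hexit hp
  rw [hb, Set.image_singleton] at hF
  rw [TileSystem.hit_eq_step hX (by rw [hF]; exact Set.singleton_nonempty _),
    TileSystem.step_singleton hF]

theorem hit_of_const (h : D.IsGrowing Γs e A q s) (hX : Γs.frontier X = ∅)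
    (hz : z = heads ∨ z = tails)
    (hexit : S.Filled (4, 3) = false) (hp : Γs.Producible (D.partialBlock e A q S ρ t z))
    (hne : (D.localFrontier S ρ t (e s) z).Nonempty) {v : ℝ≥0∞}
    (hv : ∀ x ∈ D.localFrontier S ρ t (e s) z,
      Γs.hit C X ((D.partialBlock e A q S ρ t z).place (blockCell q x.1) x.2) = v) :
    Γs.hit C X (D.partialBlock e A q S ρ t z) = v := by
  have hF := frontier_partialBlock h hz hexit hp
  have hne' : (Γs.frontier (D.partialBlock e A q S ρ t z)).Nonempty := by
    rw [hF]; exact hne.image _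
  rw [TileSystem.hit_eq_step hX hne']
  refine TileSystem.step_const hp hne' fun p b hb => ?_
  rw [hF] at hb
  obtain ⟨x, hx, heq⟩ := hb
  obtain ⟨rfl, rfl⟩ := Prod.mk.inj heq
  exact hv x hx

theorem hit_of_pair (h : D.IsGrowing Γs e A q s) (hX : Γs.frontier X = ∅)
    (hz : z = heads ∨ z = tails)
    (hexit : S.Filled (4, 3) = false) (hp : Γs.Producible (D.partialBlock e A q S ρ t z))
    {r₁ r₂ : Role} {b₁ b₂ : K × Role} (hne : (r₁, b₁) ≠ (r₂, b₂))
    (hF : D.localFrontier S ρ t (e s) z = {(r₁, b₁), (r₂, b₂)}) :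
    Γs.hit C X (D.partialBlock e A q S ρ t z) =
      C.conc b₁ / (C.conc b₁ + C.conc b₂) *
        Γs.hit C X ((D.partialBlock e A q S ρ t z).place (blockCell q r₁) b₁) +
      C.conc b₂ / (C.conc b₁ + C.conc b₂) *
        Γs.hit C X ((D.partialBlock e A q S ρ t z).place (blockCell q r₂) b₂) := by
  have hF' := frontier_partialBlock h hz hexit hp
  rw [hF, Set.image_pair] at hF'
  rw [TileSystem.hit_eq_step hX (by rw [hF']; exact Set.insert_nonempty _ _),
    TileSystem.step_pair _ hF']
  intro heq
  apply hne
  simp only [Prod.mk.injEq, blockCell_inj, true_and] at heq ⊢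
  exact heq

theorem hit_start (h : D.IsGrowing Γs e A q s)
    (hs : D.next (e s) = some ρ) (hp : Γs.Producible (D.partialBlock e A q (start 0) ρ t heads))
    {n : ℕ} (hn : n ≤ 9) :
    Γs.Producible (D.partialBlock e A q (start n) ρ t heads) ∧
      (Γs.frontier X = ∅ → Γs.hit C X (D.partialBlock e A q (start 0) ρ t heads) =
        Γs.hit C X (D.partialBlock e A q (start n) ρ t heads)) := by
  induction n with
  | zero => exact ⟨hp, fun _ => rfl⟩
  | succ n ih =>
    obtain ⟨ih1, ih2⟩ := ih (by omega)
    have hn' : n < 9 := by omega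
    have hF := localFrontier_start (t := t) hs hn'
    have hex := filled_exit.1 n hn'.le
    have hpl := place_partialBlock (D := D) (e := e) (A := A) (q := q) (ρ := ρ) (t := t)
      (z := heads) (z' := heads) (filled_start_succ n hn').1 (filled_start_succ n hn').2 (Or.inl rfl)
    simp only [roleAt, (isLate_earlyCell n hn').1, (isLate_earlyCell n hn').2, if_false,
      Bool.false_eq_true] at hpl
    refine ⟨?_, ?_⟩
    · rw [← hpl]
      exact producible_place h (Or.inl rfl) hex ih1 (by rw [hF]; rfl)
    · intro hX
      rw [ih2 hX, hit_forced h hX (Or.inl rfl) hex ih1 hF, hpl]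

theorem hit_final (h : D.IsGrowing Γs e A q s)
    (hz : z = heads ∨ z = tails)
    (hF : ∀ n < 8, D.localFrontier (final n) ρ t (e s) z = {(lateCell n, (t, lateCell n))})
    (hp : Γs.Producible (D.partialBlock e A q (final 0) ρ t z)) {n : ℕ} (hn : n ≤ 8) :
    Γs.Producible (D.partialBlock e A q (final n) ρ t z) ∧
      (Γs.frontier X = ∅ → Γs.hit C X (D.partialBlock e A q (final 0) ρ t z) =
        Γs.hit C X (D.partialBlock e A q (final n) ρ t z)) := by
  induction n with
  | zero => exact ⟨hp, fun _ => rfl⟩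
  | succ n ih =>
    obtain ⟨ih1, ih2⟩ := ih (by omega)
    have hn' : n < 8 := by omega
    have hex := filled_exit.2 n hn'
    have hpl := place_partialBlock (D := D) (e := e) (A := A) (q := q) (ρ := ρ) (t := t)
      (z := z) (z' := z) (filled_final_succ n hn').1 (filled_final_succ n hn').2 (Or.inl rfl)
    simp only [roleAt, (isLate_lateCell n hn').1, (isLate_lateCell n hn').2, if_false,
      if_true] at hpl
    refine ⟨?_, ?_⟩
    · rw [← hpl]
      exact producible_place h hz hex ih1 (by rw [hF n hn']; rfl)
    · intro hX
      rw [ih2 hX, hit_forced h hX hz hex ih1 (hF n hn'), hpl]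

end Probability

end ChainData

end ATAM

/-! ### The coin flip -/

namespace ATAM

open Role Assembly

theorem div_add_div_eq_one {a b : ℝ≥0} (ha : 0 < a) :
    (a : ℝ≥0∞) / (a + b) + b / (a + b) = 1 := by
  rw [← ENNReal.add_div, ENNReal.div_self]
  · simp [ha.ne']
  · exact ENNReal.add_ne_top.2 ⟨ENNReal.coe_ne_top, ENNReal.coe_ne_top⟩

theorem div_add_self_eq {a : ℝ≥0} (ha : 0 < a) : (a : ℝ≥0∞) / (a + a) = 2⁻¹ := by
  have h : (a : ℝ≥0∞) ≠ 0 := by simpa using ha.ne'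
  rw [← two_mul, ← ENNReal.inv_div (Or.inl ENNReal.coe_ne_top) (Or.inl h), mul_div_assoc,
    ENNReal.div_self h ENNReal.coe_ne_top, mul_one]

namespace ChainData

variable {T K : Type*} {D : ChainData K} {Γs : TileSystem (K × Role) (ℕ × ℕ × Option K)} {e : T → K}
  {A : Assembly T} {q : ℤ × ℤ} {s : T} {ρ t : K}

open Stage

theorem place_early {S S' : Stage} {r : Role} {z z' : Role} (hr : S'.Filled r = true)
    (hf : ∀ r', r' ≠ r → S'.Filled r' = S.Filled r') (hz : z = z' ∨ r = contested)
    (hl : r.IsLate = false) :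
    (D.partialBlock e A q S ρ t z).place (blockCell q r) (ρ, roleAt z' r) =
      D.partialBlock e A q S' ρ t z' := by
  rw [← place_partialBlock hr hf hz, hl]
  rfl

theorem place_trigger :
    (D.partialBlock e A q (start 9) ρ t heads).place (blockCell q heads) (ρ, heads) =
      D.partialBlock e A q ⟨9, true, false, false, 0⟩ ρ t heads ∧
    (D.partialBlock e A q (start 9) ρ t heads).place (blockCell q tails) (ρ, tails) =
      D.partialBlock e A q ⟨9, false, true, false, 0⟩ ρ t heads :=
  ⟨place_early (by decide) (by decide) (Or.inl rfl) rfl,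
    place_early (by decide) (by decide) (Or.inl rfl) rfl⟩

theorem place_heads :
    (D.partialBlock e A q ⟨9, true, false, false, 0⟩ ρ t heads).place (blockCell q tails) (ρ, tails) =
      D.partialBlock e A q ⟨9, true, true, false, 0⟩ ρ t heads ∧
    (D.partialBlock e A q ⟨9, true, false, false, 0⟩ ρ t heads).place (blockCell q contested)
      (ρ, tails) = D.partialBlock e A q ⟨9, true, false, true, 0⟩ ρ t tails :=
  ⟨place_early (by decide) (by decide) (Or.inl rfl) rfl,
    place_early (z' := tails) (by decide) (by decide) (Or.inr rfl) rfl⟩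

theorem place_tails :
    (D.partialBlock e A q ⟨9, false, true, false, 0⟩ ρ t heads).place (blockCell q contested)
      (ρ, heads) = D.partialBlock e A q ⟨9, false, true, true, 0⟩ ρ t heads ∧
    (D.partialBlock e A q ⟨9, false, true, false, 0⟩ ρ t heads).place (blockCell q heads) (ρ, heads) =
      D.partialBlock e A q ⟨9, true, true, false, 0⟩ ρ t heads :=
  ⟨place_early (z' := heads) (by decide) (by decide) (Or.inr rfl) rfl,
    place_early (by decide) (by decide) (Or.inl rfl) rfl⟩

theorem place_both :
    (D.partialBlock e A q ⟨9, true, true, false, 0⟩ ρ t heads).place (blockCell q contested)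
      (ρ, heads) = D.partialBlock e A q (final 0) ρ t heads ∧
    (D.partialBlock e A q ⟨9, true, true, false, 0⟩ ρ t heads).place (blockCell q contested)
      (ρ, tails) = D.partialBlock e A q (final 0) ρ t tails :=
  ⟨place_early (z' := heads) (by decide) (by decide) (Or.inr rfl) rfl,
    place_early (z' := tails) (by decide) (by decide) (Or.inr rfl) rfl⟩

/-- A row to which no tile can be attached. -/
theorem frontier_eq_empty_of_next_eq_none (h : D.IsGrowing Γs e A q s) (hs : D.next (e s) = none)
    (hp : Γs.Producible (A.blockReplace (D.blocks e))) :
    Γs.frontier (A.blockReplace (D.blocks e)) = ∅ := by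
  rw [← partialBlock_start_zero (ρ := e s) (t := e s) (z := heads) h] at hp ⊢
  rw [frontier_partialBlock h (Or.inl rfl) (by decide) hp, localFrontier_start_of_none hs,
    Set.image_empty]

variable [Fintype K] {C : Concentration (K × Role)} {X : Assembly (K × Role)}

/-- The missing cell `(0, 2)` is enclosed by the early path, the contested cell and the block on the
west, and accepts only `heads`. Hence it may be filled first, although the late path can in fact run
ahead of it. -/
theorem hit_tails_heads (h : D.IsGrowing Γs e A q s) (hρ : D.rep ρ = ρ)
    (hp : Γs.Producible (D.partialBlock e A q ⟨9, false, true, true, 0⟩ ρ t heads)) :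
    Γs.Producible (D.partialBlock e A q (final 0) ρ t heads) ∧
    (Γs.frontier X = ∅ → Γs.hit C X (D.partialBlock e A q ⟨9, false, true, true, 0⟩ ρ t heads) =
      Γs.hit C X (D.partialBlock e A q (final 0) ρ t heads)) := by
  rw [partialBlock_congr (t' := ρ) (S := ⟨9, false, true, true, 0⟩) rfl] at hp ⊢
  rw [partialBlock_congr (t' := ρ) (S := final 0) rfl]
  have hF := frontier_partialBlock h (Or.inl rfl) (by decide) hp
  rw [localFrontier_tails_heads hρ, Set.image_pair] at hF
  have hpl := place_early (D := D) (e := e) (A := A) (q := q) (ρ := ρ) (t := ρ)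
    (S := ⟨9, false, true, true, 0⟩) (S' := final 0) (r := heads) (z := heads) (z' := heads)
    (by decide) (by decide) (Or.inl rfl) rfl
  have hmem : (blockCell q heads, ((ρ, heads) : K × Role)) ∈
      Γs.frontier (D.partialBlock e A q ⟨9, false, true, true, 0⟩ ρ ρ heads) := by
    rw [hF]; exact Or.inl rfl
  rw [← hpl]
  refine ⟨hp.attach hmem, fun hX => TileSystem.hit_place_of_enclosed hX hp hmem ?_ ?_⟩
  · intro b hb
    rw [hF] at hb
    rcases hb with hb | hb
    · exact (Prod.mk.inj hb).2
    · have := (blockCell_inj.1 (Prod.mk.inj hb).1).2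
      exact absurd (show heads = (0, 0) from this) (by decide)
  · obtain ⟨x₀, a, hA, -⟩ := h.row
    intro d
    rw [partialBlock, cell_neighbor hA]
    cases d <;> simp [look, contents, Filled, rank, IsLate]

/-- The missing cell `(1, 1)` is not enclosed, because `(1, 0)` below it is empty. But the late path
can place only one tile before it, so it suffices to compare two orders of two attachments. -/
theorem hit_heads_tails (h : D.IsGrowing Γs e A q s) (ht : D.rep t = ρ)
    (hne : t ≠ ρ) (huniq : ∀ k, D.rep k = ρ → k = ρ ∨ k = t)
    (hp : Γs.Producible (D.partialBlock e A q ⟨9, true, false, true, 0⟩ ρ t tails)) :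
    Γs.Producible (D.partialBlock e A q (final 0) ρ t tails) ∧
    (Γs.frontier X = ∅ → Γs.hit C X (D.partialBlock e A q ⟨9, true, false, true, 0⟩ ρ t tails) =
      Γs.hit C X (D.partialBlock e A q (final 0) ρ t tails)) := by
  have hF := localFrontier_heads_tails (s := e s) ht hne huniq
  have hpl := place_early (D := D) (e := e) (A := A) (q := q) (ρ := ρ) (t := t)
    (S := ⟨9, true, false, true, 0⟩) (S' := final 0) (r := tails) (z := tails) (z' := tails)
    (by decide) (by decide) (Or.inl rfl) rfl
  have hpl' := place_early (D := D) (e := e) (A := A) (q := q) (ρ := ρ) (t := t)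
    (S := ⟨9, true, false, true, 1⟩) (S' := final 1) (r := tails) (z := tails) (z' := tails)
    (by decide) (by decide) (Or.inl rfl) rfl
  have hpl₀ : (D.partialBlock e A q ⟨9, true, false, true, 0⟩ ρ t tails).place
      (blockCell q (0, 0)) (t, (0, 0)) = D.partialBlock e A q ⟨9, true, false, true, 1⟩ ρ t tails :=
    place_partialBlock (by decide) (by decide) (Or.inl rfl)
  have hp₁ : Γs.Producible (D.partialBlock e A q (final 0) ρ t tails) := by
    rw [← hpl]
    exact producible_place h (Or.inr rfl) (by decide) hp (by rw [hF]; exact Or.inl rfl)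
  have hp₂ : Γs.Producible (D.partialBlock e A q ⟨9, true, false, true, 1⟩ ρ t tails) := by
    rw [← hpl₀]
    exact producible_place h (Or.inr rfl) (by decide) hp (by rw [hF]; exact Or.inr rfl)
  refine ⟨hp₁, fun hX => hit_of_const h hX (Or.inr rfl) (by decide) hp (by rw [hF]; exact ⟨_, Or.inl rfl⟩) ?_⟩
  intro x hx
  rw [hF] at hx
  rcases hx with rfl | rfl
  · exact congrArg _ hpl
  · dsimp only
    rw [hpl₀, hit_forced h hX (Or.inr rfl) (by decide) hp₂ localFrontier_heads_tails_late]
    refine (congrArg _ hpl').trans ?_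
    exact (hit_final h (Or.inr rfl)
      (fun n hn => localFrontier_final_tails ht hne huniq hn) hp₁ (n := 1) (by norm_num)).2 hX |>.symm

/-- Without a partner `tails` cannot bind below `heads`, so each order of attachment reaches the
same stage with `heads` as the winner. -/
theorem hit_trigger_of_not_paired (h : D.IsGrowing Γs e A q s)
    (hs : D.next (e s) = some ρ) (hρ : D.rep ρ = ρ) (hpair : ¬ D.Paired ρ)
    (hp : Γs.Producible (D.partialBlock e A q (start 9) ρ t heads)) :
    Γs.Producible (D.partialBlock e A q (final 0) ρ t heads) ∧
    (Γs.frontier X = ∅ → Γs.hit C X (D.partialBlock e A q (start 9) ρ t heads) =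
      Γs.hit C X (D.partialBlock e A q (final 0) ρ t heads)) := by
  have hF₀ := localFrontier_trigger (D := D) (ρ := ρ) (t := t) (s := e s)
  have hF₁ := localFrontier_heads (t := t) hs
  have hF₂ := localFrontier_tails (t := t) hs
  have hF₃ := localFrontier_both (t := t) hs
  simp only [hpair, and_false, or_false, Set.ofPred_eq_eq_singleton] at hF₁ hF₃
  have hz : heads = heads ∨ heads = tails := Or.inl rfl
  have hp₁ : Γs.Producible (D.partialBlock e A q ⟨9, true, false, false, 0⟩ ρ t heads) := by
    rw [← place_trigger.1]
    exact producible_place h hz (by decide) hp (by rw [hF₀]; exact Or.inl rfl)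
  have hp₂ : Γs.Producible (D.partialBlock e A q ⟨9, false, true, false, 0⟩ ρ t heads) := by
    rw [← place_trigger.2]
    exact producible_place h hz (by decide) hp (by rw [hF₀]; exact Or.inr rfl)
  have hp₃ : Γs.Producible (D.partialBlock e A q ⟨9, true, true, false, 0⟩ ρ t heads) := by
    rw [← place_heads.1]
    exact producible_place h hz (by decide) hp₁ (by rw [hF₁]; rfl)
  have hp₄ : Γs.Producible (D.partialBlock e A q ⟨9, false, true, true, 0⟩ ρ t heads) := by
    rw [← place_tails.1]
    exact producible_place h hz (by decide) hp₂ (by rw [hF₂]; exact Or.inl rfl)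
  obtain ⟨hp₅, h₄⟩ := hit_tails_heads (C := C) (X := X) h hρ hp₄
  have h₃ : Γs.frontier X = ∅ → Γs.hit C X (D.partialBlock e A q ⟨9, true, true, false, 0⟩ ρ t heads) =
      Γs.hit C X (D.partialBlock e A q (final 0) ρ t heads) := by
    intro hX
    rw [hit_forced h hX hz (by decide) hp₃ hF₃, place_both.1]
  refine ⟨hp₅, fun hX => hit_of_const h hX hz (by decide) hp (by rw [hF₀]; exact ⟨_, Or.inl rfl⟩) ?_⟩
  rw [hF₀]
  rintro x (rfl | rfl) <;> dsimp only
  · rw [place_trigger.1, hit_forced h hX hz (by decide) hp₁ hF₁, place_heads.1, h₃ hX]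
  · rw [place_trigger.2]
    refine hit_of_const h hX hz (by decide) hp₂ (by rw [hF₂]; exact ⟨_, Or.inl rfl⟩) ?_
    rw [hF₂]
    rintro x (rfl | rfl) <;> dsimp only
    · rw [place_tails.1, h₄ hX]
    · rw [place_tails.2, h₃ hX]

theorem hit_trigger_of_paired (h : D.IsGrowing Γs e A q s)
    (hs : D.next (e s) = some ρ) (hρ : D.rep ρ = ρ) (ht : D.rep t = ρ) (hne : t ≠ ρ)
    (huniq : ∀ k, D.rep k = ρ → k = ρ ∨ k = t)
    (hp : Γs.Producible (D.partialBlock e A q (start 9) ρ t heads)) :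
    Γs.Producible (D.partialBlock e A q (final 0) ρ t heads) ∧
    Γs.Producible (D.partialBlock e A q (final 0) ρ t tails) ∧
    (Γs.frontier X = ∅ → Γs.hit C X (D.partialBlock e A q (start 9) ρ t heads) =
      2⁻¹ * Γs.hit C X (D.partialBlock e A q (final 0) ρ t heads) +
      2⁻¹ * Γs.hit C X (D.partialBlock e A q (final 0) ρ t tails)) := by
  have hpair : D.Paired ρ := ⟨t, hne, ht⟩
  have hF₀ := localFrontier_trigger (D := D) (ρ := ρ) (t := t) (s := e s)
  have hF₁ : D.localFrontier ⟨9, true, false, false, 0⟩ ρ t (e s) heads =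
      {(tails, (ρ, tails)), (contested, (ρ, tails))} := by
    rw [localFrontier_heads hs]; ext x; simp [hpair]
  have hF₂ := localFrontier_tails (t := t) hs
  have hF₃ : D.localFrontier ⟨9, true, true, false, 0⟩ ρ t (e s) heads =
      {(contested, (ρ, heads)), (contested, (ρ, tails))} := by
    rw [localFrontier_both hs]; ext x; simp [hpair]
  have hz : heads = heads ∨ heads = tails := Or.inl rfl
  have hp₁ : Γs.Producible (D.partialBlock e A q ⟨9, true, false, false, 0⟩ ρ t heads) := by
    rw [← place_trigger.1]
    exact producible_place h hz (by decide) hp (by rw [hF₀]; exact Or.inl rfl)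
  have hp₂ : Γs.Producible (D.partialBlock e A q ⟨9, false, true, false, 0⟩ ρ t heads) := by
    rw [← place_trigger.2]
    exact producible_place h hz (by decide) hp (by rw [hF₀]; exact Or.inr rfl)
  have hp₃ : Γs.Producible (D.partialBlock e A q ⟨9, true, true, false, 0⟩ ρ t heads) := by
    rw [← place_heads.1]
    exact producible_place h hz (by decide) hp₁ (by rw [hF₁]; exact Or.inl rfl)
  have hp₄ : Γs.Producible (D.partialBlock e A q ⟨9, false, true, true, 0⟩ ρ t heads) := by
    rw [← place_tails.1]
    exact producible_place h hz (by decide) hp₂ (by rw [hF₂]; exact Or.inl rfl)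
  have hp₅ : Γs.Producible (D.partialBlock e A q ⟨9, true, false, true, 0⟩ ρ t tails) := by
    rw [← place_heads.2]
    exact producible_place h hz (by decide) hp₁ (by rw [hF₁]; exact Or.inr rfl)
  obtain ⟨hp₆, h₄⟩ := hit_tails_heads (C := C) (X := X) h hρ hp₄
  obtain ⟨hp₇, h₅⟩ := hit_heads_tails (C := C) (X := X) h ht hne huniq hp₅
  refine ⟨hp₆, hp₇, fun hX => ?_⟩
  have h₃ := hit_of_pair (C := C) h hX hz (by decide) hp₃ (by simp) hF₃
  have h₂ := hit_of_pair (C := C) h hX hz (by decide) hp₂ (by simp) hF₂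
  have h₁ := hit_of_pair (C := C) h hX hz (by decide) hp₁ (by simp) hF₁
  have h₀ := hit_of_pair (C := C) h hX hz (by decide) hp (by simp) hF₀
  rw [place_both.1, place_both.2] at h₃
  -- In these two stages both competing tiles have the same type, whence the factor `2⁻¹`.
  rw [place_tails.1, place_tails.2, h₄ hX, div_add_self_eq (C.conc_pos _)] at h₂
  rw [place_heads.1, place_heads.2, h₅ hX, div_add_self_eq (C.conc_pos _)] at h₁
  rw [place_trigger.1, place_trigger.2, h₁, h₂, h₃] at h₀
  rw [h₀]
  have hsum := div_add_div_eq_one (b := C.conc (ρ, tails)) (C.conc_pos (ρ, heads))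
  generalize (C.conc (ρ, heads) : ℝ≥0∞) / (C.conc (ρ, heads) + C.conc (ρ, tails)) = a at hsum ⊢
  generalize (C.conc (ρ, tails) : ℝ≥0∞) / (C.conc (ρ, heads) + C.conc (ρ, tails)) = b at hsum ⊢
  generalize Γs.hit C X (D.partialBlock e A q (final 0) ρ t heads) = x
  generalize Γs.hit C X (D.partialBlock e A q (final 0) ρ t tails) = y
  -- The only concentrations left are in the first attachment and in the contest with both opponents
  -- placed. The path with both placed has weight `(a + b) / 2 = 1/2`, and the direct wins `a / 2`
  -- of `tails` and `b / 2` of `heads` correct its bias exactly.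
  calc _ = (a + b) * (2⁻¹ * (a * x + b * y)) + 2⁻¹ * (a * y + b * x) := by ring
    _ = 1 * (2⁻¹ * (a * x + b * y)) + 2⁻¹ * (a * y + b * x) := by rw [hsum]
    _ = 2⁻¹ * ((a + b) * x) + 2⁻¹ * ((a + b) * y) := by ring
    _ = _ := by rw [hsum, one_mul, one_mul]

theorem producible_hit_final_heads (h : D.IsGrowing Γs e A q s) {u : T}
    (hρ : D.rep (e u) = e u)
    (hp : Γs.Producible (D.partialBlock e A q (final 0) (e u) t heads)) :
    Γs.Producible ((A.place q u).blockReplace (D.blocks e)) ∧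
    (Γs.frontier X = ∅ → Γs.hit C X (D.partialBlock e A q (final 0) (e u) t heads) =
      Γs.hit C X ((A.place q u).blockReplace (D.blocks e))) := by
  rw [partialBlock_congr (t' := e u) rfl] at hp ⊢
  have := hit_final (C := C) (X := X) h (Or.inl rfl)
    (fun n hn => localFrontier_final_heads hρ hn) hp (n := 8) le_rfl
  have hb := partialBlock_final (D := D) (e := e) (A := A) (q := q) u
  have hw : D.winner (e u) = heads := by simp [winner, hρ]
  rw [hρ, hw] at hb
  rwa [hb] at this

theorem producible_hit_final_tails (h : D.IsGrowing Γs e A q s) {v : T}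
    (ht : D.rep (e v) = ρ) (hne : e v ≠ ρ) (huniq : ∀ k, D.rep k = ρ → k = ρ ∨ k = e v)
    (hp : Γs.Producible (D.partialBlock e A q (final 0) ρ (e v) tails)) :
    Γs.Producible ((A.place q v).blockReplace (D.blocks e)) ∧
    (Γs.frontier X = ∅ → Γs.hit C X (D.partialBlock e A q (final 0) ρ (e v) tails) =
      Γs.hit C X ((A.place q v).blockReplace (D.blocks e))) := by
  have := hit_final (C := C) (X := X) h (Or.inr rfl)
    (fun n hn => localFrontier_final_tails ht hne huniq hn) hp (n := 8) le_rfl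
  have hb := partialBlock_final (D := D) (e := e) (A := A) (q := q) v
  have hw : D.winner (e v) = tails := by
    rw [winner, if_neg]; rw [ht]; exact hne.symm
  rw [ht, hw] at hb
  rwa [hb] at this

/-- A row to which one tile type can be attached. -/
theorem hit_of_not_paired (h : D.IsGrowing Γs e A q s) {u : T}
    (hs : D.next (e s) = some (e u)) (hρ : D.rep (e u) = e u) (hpair : ¬ D.Paired (e u))
    (hp : Γs.Producible (A.blockReplace (D.blocks e))) :
    Γs.Producible ((A.place q u).blockReplace (D.blocks e)) ∧
    (Γs.frontier X = ∅ → Γs.hit C X (A.blockReplace (D.blocks e)) =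
      Γs.hit C X ((A.place q u).blockReplace (D.blocks e))) := by
  rw [← partialBlock_start_zero (ρ := e u) (t := e u) (z := heads) h] at hp ⊢
  obtain ⟨hp₁, h₁⟩ := hit_start (C := C) (X := X) h hs hp le_rfl
  obtain ⟨hp₂, h₂⟩ := hit_trigger_of_not_paired (C := C) (X := X) h hs hρ hpair hp₁
  obtain ⟨hp₃, h₃⟩ := producible_hit_final_heads (C := C) (X := X) h hρ hp₂
  exact ⟨hp₃, fun hX => (h₁ hX).trans ((h₂ hX).trans (h₃ hX))⟩

/-- A row to which one of two tile types can be attached. -/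
theorem hit_of_paired (h : D.IsGrowing Γs e A q s) {u v : T}
    (hs : D.next (e s) = some (e u)) (hρ : D.rep (e u) = e u) (ht : D.rep (e v) = e u)
    (hne : e v ≠ e u) (huniq : ∀ k, D.rep k = e u → k = e u ∨ k = e v)
    (hp : Γs.Producible (A.blockReplace (D.blocks e))) :
    Γs.Producible ((A.place q u).blockReplace (D.blocks e)) ∧
    Γs.Producible ((A.place q v).blockReplace (D.blocks e)) ∧
    (Γs.frontier X = ∅ → Γs.hit C X (A.blockReplace (D.blocks e)) =
      2⁻¹ * Γs.hit C X ((A.place q u).blockReplace (D.blocks e)) +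
      2⁻¹ * Γs.hit C X ((A.place q v).blockReplace (D.blocks e))) := by
  rw [← partialBlock_start_zero (ρ := e u) (t := e v) (z := heads) h] at hp ⊢
  obtain ⟨hp₁, h₁⟩ := hit_start (C := C) (X := X) h hs hp le_rfl
  obtain ⟨hp₂, hp₃, h₂⟩ := hit_trigger_of_paired (C := C) (X := X) h hs hρ ht hne huniq hp₁
  obtain ⟨hp₄, h₄⟩ := producible_hit_final_heads (C := C) (X := X) h hρ hp₂
  obtain ⟨hp₅, h₅⟩ := producible_hit_final_tails (C := C) (X := X) h ht hne huniq hp₃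
  exact ⟨hp₄, hp₅, fun hX => by rw [h₁ hX, h₂ hX, h₄ hX, h₅ hX]⟩

end ChainData

end ATAM

set_option linter.unusedSimpArgs false

/-! ### Internal connectivity of complete blocks -/

namespace ATAM

open Role Assembly

theorem Assembly.bond_add_vec {T G : Type*} (glue : T → Side → G) (str : G → ℕ) {A : Assembly T}
    {p : ℤ × ℤ} {d : Side} {a b : T} (ha : A.cell p = some a) (hb : A.cell (p + d.vec) = some b) :
    A.bond glue str p (p + d.vec) = bondWith glue str a d (some b) := by
  classical
  unfold bond
  rw [ha, hb, bondWith_some]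
  dsimp only
  rw [Finset.sum_eq_single d]
  · simp
  · intro d' _ hd
    rw [if_neg]
    rintro ⟨h, -⟩
    exact hd (Side.vec_injective (add_left_cancel h)).symm
  · simp

/-- If at most one edge of a 4-cycle is cut, then no edge is cut. The cycle consists of the
contested cell, `(0, 0)`, `(1, 0)` and the part of the block already known to stay together. -/
theorem iff_of_cycle {a b c d : Prop} (h₁ : (b ↔ a) ∨ (b ↔ c)) (h₂ : (b ↔ a) ∨ (c ↔ d))
    (h₃ : (b ↔ a) ∨ (d ↔ a)) (h₄ : (b ↔ c) ∨ (c ↔ d)) (h₅ : (b ↔ c) ∨ (d ↔ a))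
    (h₆ : (c ↔ d) ∨ (d ↔ a)) : (b ↔ a) ∧ (c ↔ a) ∧ (d ↔ a) := by
  by_cases a <;> by_cases b <;> by_cases c <;> by_cases d <;> simp_all

namespace ChainData

variable {T K : Type*} {D : ChainData K}

theorem two_le_bond_block (k : K) : ∀ x ∈ ([((0, 3), .east, (1, 3)), ((1, 3), .east, (2, 3)),
    ((2, 3), .east, (3, 3)), ((3, 3), .south, (3, 2)), ((3, 2), .south, (3, 1)),
    ((3, 1), .west, (2, 1)), ((2, 1), .north, (2, 2)), ((2, 2), .west, (1, 2)),
    ((1, 0), .east, (2, 0)), ((2, 0), .east, (3, 0)), ((3, 0), .east, (4, 0)),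
    ((4, 0), .north, (4, 1)), ((4, 1), .north, (4, 2)), ((4, 2), .north, (4, 3))] :
      List (Role × Side × Role)),
    2 ≤ bondWith D.glue glueStr (D.block k x.1) x.2.1 (some (D.block k x.2.2)) := by
  classical
  simp [bondWith_glue, block, glueData, label, labelTable, sideIndex, IsLate, roleAt, Side.opp,
    labelStr]

theorem one_le_bond_block (k : K) :
    ∀ x ∈ ([((1, 1), .north, (1, 2)), ((1, 1), .east, (2, 1)), ((0, 2), .north, (0, 3)),
    ((0, 2), .east, (1, 2)), ((0, 1), .south, (0, 0)), ((0, 0), .east, (1, 0)),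
    ((1, 0), .north, (1, 1))] : List (Role × Side × Role)),
    1 ≤ bondWith D.glue glueStr (D.block k x.1) x.2.1 (some (D.block k x.2.2)) := by
  classical
  have hp : D.rep k ≠ k → D.Paired (D.rep k) := fun h => ⟨k, h.symm, rfl⟩
  by_cases h : D.rep k = k <;>
  simp [bondWith_glue, block, glueData, label, labelTable, sideIndex, IsLate, roleAt, Side.opp,
    labelStr, winner, h, hp]

/-- The two cases are the two winners: `heads` binds to its opponent on the east, `tails` to its
opponent on the north. Bonds to the western block are not used, since the first block of the seed
has none. -/
theorem one_le_bond_contested (k : K) :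
    1 ≤ bondWith D.glue glueStr (D.block k (0, 1)) .east (some (D.block k (1, 1))) ∨
    1 ≤ bondWith D.glue glueStr (D.block k (0, 1)) .north (some (D.block k (0, 2))) := by
  classical
  have hp : D.rep k ≠ k → D.Paired (D.rep k) := fun h => ⟨k, h.symm, rfl⟩
  by_cases h : D.rep k = k <;>
  simp [bondWith_glue, block, glueData, label, labelTable, sideIndex, IsLate, roleAt, Side.opp,
    labelStr, winner, h, hp]

theorem two_le_bond_exit {k k' : K} (h : D.next k = some (D.rep k')) :
    2 ≤ bondWith D.glue glueStr (D.block k (4, 3)) .east (some (D.block k' (0, 3))) := by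
  classical
  simp [bondWith_glue, block, glueData, label, labelTable, sideIndex, IsLate, roleAt, Side.opp,
    labelStr, h]

theorem bond_blockReplace {e : T → K} {A : Assembly T} {q : ℤ × ℤ} {t : T} (ht : A.cell q = some t)
    {r r' : Role} {d : Side} (h : blockCell q r + d.vec = blockCell q r') :
    (A.blockReplace (D.blocks e)).bond D.glue glueStr (blockCell q r) (blockCell q r') =
      bondWith D.glue glueStr (D.block (e t) r) d (some (D.block (e t) r')) := by
  rw [← h]
  refine bond_add_vec _ _ ?_ ?_
  · rw [cell_blockReplace, ht]; rfl
  · rw [h, cell_blockReplace, ht]; rfl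

/-- The contents of a complete block are not separated by a cut of weight less than two. -/
theorem mem_iff_of_block {e : T → K} {A : Assembly T} {S : Finset (ℤ × ℤ)}
    (hS : ∑ p ∈ S, ∑ q ∈ (A.blockReplace (D.blocks e)).dom \ S,
      (A.blockReplace (D.blocks e)).bond D.glue glueStr p q < 2)
    {q : ℤ × ℤ} {t : T} (ht : A.cell q = some t) (r : Role) : blockCell q r ∈ S ↔ blockCell q (0, 3) ∈ S := by
  have hs : ∀ x ∈ _, _ := two_le_bond_block (D := D) (e t)
  have hw : ∀ x ∈ _, _ := one_le_bond_block (D := D) (e t)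
  have hz := one_le_bond_contested (D := D) (e t)
  simp only [List.forall_mem_cons, List.not_mem_nil, false_imp_iff, implies_true, and_true] at hs hw
  have hadj : ∀ (r r' : Role) (d : Side), blockCell (0, 0) r + d.vec = blockCell (0, 0) r' →
      blockCell q r + d.vec = blockCell q r' := by
    intro r r' d h
    simp only [blockCell, Prod.ext_iff, Prod.fst_add, Prod.snd_add] at h ⊢
    omega
  have strong : ∀ {r r' : Role} {d : Side}, blockCell (0, 0) r + d.vec = blockCell (0, 0) r' →
      2 ≤ bondWith D.glue glueStr (D.block (e t) r) d (some (D.block (e t) r')) →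
      (blockCell q r ∈ S ↔ blockCell q r' ∈ S) := by
    intro r r' d h h2
    rw [← bond_blockReplace ht (hadj _ _ _ h)] at h2
    exact not_separated hS h2
  have weak : ∀ {r₁ r₁' r₂ r₂' : Role} {d₁ d₂ : Side},
      blockCell (0, 0) r₁ + d₁.vec = blockCell (0, 0) r₁' →
      blockCell (0, 0) r₂ + d₂.vec = blockCell (0, 0) r₂' →
      (r₁ ≠ r₂ ∨ r₁' ≠ r₂') ∧ (r₁ ≠ r₂' ∨ r₁' ≠ r₂) →
      1 ≤ bondWith D.glue glueStr (D.block (e t) r₁) d₁ (some (D.block (e t) r₁')) →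
      1 ≤ bondWith D.glue glueStr (D.block (e t) r₂) d₂ (some (D.block (e t) r₂')) →
      (blockCell q r₁ ∈ S ↔ blockCell q r₁' ∈ S) ∨ (blockCell q r₂ ∈ S ↔ blockCell q r₂' ∈ S) := by
    intro r₁ r₁' r₂ r₂' d₁ d₂ h₁ h₂ hne hb₁ hb₂
    rw [← bond_blockReplace ht (hadj _ _ _ h₁)] at hb₁
    rw [← bond_blockReplace ht (hadj _ _ _ h₂)] at hb₂
    refine not_separated_pair hS hb₁ hb₂ ?_
    simpa [blockCell_inj] using hne
  obtain ⟨s1, s2, s3, s4, s5, s6, s7, s8, s9, s10, s11, s12, s13, s14⟩ := hs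
  obtain ⟨w1, w2, w3, w4, w5, w6, w7⟩ := hw
  replace s1 := strong (by decide) s1
  replace s2 := strong (by decide) s2
  replace s3 := strong (by decide) s3
  replace s4 := strong (by decide) s4
  replace s5 := strong (by decide) s5
  replace s6 := strong (by decide) s6
  replace s7 := strong (by decide) s7
  replace s8 := strong (by decide) s8
  replace s9 := strong (by decide) s9
  replace s10 := strong (by decide) s10
  replace s11 := strong (by decide) s11
  replace s12 := strong (by decide) s12
  replace s13 := strong (by decide) s13
  replace s14 := strong (by decide) s14
  -- The cells `(1, 1)` and `(0, 2)` have two unit bonds each to the early path, and a light cut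
  -- separates at most one bond of each pair.
  have a1 := weak (by decide) (by decide) (by decide) w1 w2
  have a2 := weak (by decide) (by decide) (by decide) w3 w4
  have b1 := weak (by decide) (by decide) (by decide) w5 w6
  have b2 := weak (by decide) (by decide) (by decide) w5 w7
  have b3 := weak (by decide) (by decide) (by decide) w6 w7
  have hd : blockCell q (1, 2) ∈ S ↔ blockCell q (0, 3) ∈ S := by
    rw [← s8, ← s7, ← s6, ← s5, ← s4, ← s3, ← s2, ← s1]
  have hp6 : blockCell q (2, 1) ∈ S ↔ blockCell q (0, 3) ∈ S := by
    rw [← hd, ← s8, ← s7]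
  have hu : blockCell q (1, 1) ∈ S ↔ blockCell q (0, 3) ∈ S := by
    rw [hd, hp6] at a1
    simpa using a1
  have hv : blockCell q (0, 2) ∈ S ↔ blockCell q (0, 3) ∈ S := by
    rw [hd] at a2
    simpa using a2
  have hzF : (blockCell q (0, 1) ∈ S ↔ blockCell q (0, 3) ∈ S) ∧
      (blockCell q (0, 0) ∈ S ↔ blockCell q (0, 3) ∈ S) ∧
      (blockCell q (1, 0) ∈ S ↔ blockCell q (0, 3) ∈ S) := by
    rcases hz with hz | hz
    · have c1 := weak (by decide) (by decide) (by decide) hz w5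
      have c2 := weak (by decide) (by decide) (by decide) hz w6
      have c3 := weak (by decide) (by decide) (by decide) hz w7
      rw [hu] at b2 b3 c1 c2 c3
      exact iff_of_cycle c1 c2 c3 b1 b2 b3
    · have c1 := weak (by decide) (by decide) (by decide) hz w5
      have c2 := weak (by decide) (by decide) (by decide) hz w6
      have c3 := weak (by decide) (by decide) (by decide) hz w7
      rw [hu] at b2 b3 c3
      rw [hv] at c1 c2 c3
      exact iff_of_cycle c1 c2 c3 b1 b2 b3
  obtain ⟨hz', hF0, hF1⟩ := hzF
  obtain ⟨i, j⟩ := r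
  fin_cases i
  · fin_cases j
    exacts [hF0, hz', hv, Iff.rfl]
  · fin_cases j
    exacts [hF1, hu, hd, s1.symm]
  · have h20 := s9.symm.trans hF1
    fin_cases j
    exacts [h20, hp6, s7.symm.trans hp6, (s1.trans s2).symm]
  · have h33 := ((s1.trans s2).trans s3).symm
    fin_cases j
    exacts [(s9.trans s10).symm.trans hF1, (s4.trans s5).symm.trans h33, s4.symm.trans h33, h33]
  · have h40 := ((s9.trans s10).trans s11).symm.trans hF1
    fin_cases j
    exacts [h40, s12.symm.trans h40, (s12.trans s13).symm.trans h40,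
      ((s12.trans s13).trans s14).symm.trans h40]

end ChainData

end ATAM

/-! ### Stability of rows of blocks -/

namespace ATAM

open Role Assembly

namespace ChainData

variable {T K : Type*} {D : ChainData K} {e : T → K} {A : Assembly T}

theorem stable_blockReplace {x₀ : ℤ} {q : ℤ × ℤ}
    (hA : ∀ p, A.cell p ≠ none ↔ p.2 = q.2 ∧ x₀ ≤ p.1 ∧ p.1 < q.1)
    (hnext : ∀ x s t, A.cell (x, q.2) = some s → A.cell (x + 1, q.2) = some t →
      D.next (e s) = some (D.rep (e t))) :
    (A.blockReplace (D.blocks e)).Stable D.glue glueStr 2 := by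
  intro S hsub hne hneq
  by_contra hlt
  rw [not_le] at hlt
  have hsome : ∀ x, x₀ ≤ x → x < q.1 → ∃ t, A.cell (x, q.2) = some t := fun x h1 h2 =>
    Option.ne_none_iff_exists'.1 ((hA (x, q.2)).2 ⟨rfl, h1, h2⟩)
  have hconst : ∀ x, x₀ ≤ x → x < q.1 →
      (blockCell (x, q.2) (0, 3) ∈ S ↔ blockCell (x₀, q.2) (0, 3) ∈ S) := by
    intro x hx
    induction x, hx using Int.leInduction with
    | base => exact fun _ => Iff.rfl
    | succ x hx ih =>
      intro hlt'
      obtain ⟨s, hs⟩ := hsome x hx (by omega)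
      obtain ⟨t, ht⟩ := hsome (x + 1) (by omega) hlt'
      rw [← ih (by omega), ← mem_iff_of_block hlt hs (4, 3)]
      have hv : blockCell (x, q.2) (4, 3) + Side.east.vec = blockCell (x + 1, q.2) (0, 3) := by
        have h4 : ((4 : Fin 5) : ℕ) = 4 := rfl
        simp only [blockCell, Side.vec, Prod.mk_add_mk, Prod.mk.injEq, Fin.val_zero, h4]
        omega
      have hb := bond_add_vec D.glue glueStr (A := A.blockReplace (D.blocks e))
        (p := blockCell (x, q.2) (4, 3)) (d := .east) (a := D.block (e s) (4, 3))
        (b := D.block (e t) (0, 3)) (by rw [cell_blockReplace, hs]; rfl)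
        (by rw [hv, cell_blockReplace, ht]; rfl)
      rw [hv] at hb
      exact (not_separated hlt (hb ▸ two_le_bond_exit (hnext x s t hs ht))).symm
  -- Complete blocks are not separated inside, and consecutive ones are joined by a strength-2 exit.
  -- So all occupied cells lie on one side of the cut, and it is not proper.
  have hall : ∀ p ∈ (A.blockReplace (D.blocks e)).dom,
      (p ∈ S ↔ blockCell (x₀, q.2) (0, 3) ∈ S) := by
    intro p hp
    rw [mem_dom, ← blockCell_surjective p, cell_blockReplace] at hp
    have hc : A.cell (blockOf p) ≠ none := by
      intro h; rw [h] at hp; exact hp rfl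
    obtain ⟨h1, h2, h3⟩ := (hA _).1 hc
    obtain ⟨t, ht⟩ := Option.ne_none_iff_exists'.1 hc
    have := mem_iff_of_block hlt ht (roleOf p)
    rw [blockCell_surjective] at this
    rw [this, ← hconst _ h2 h3, ← h1]
  by_cases h0 : blockCell (x₀, q.2) (0, 3) ∈ S
  · exact hneq (hsub.antisymm fun p hp => (hall p hp).2 h0)
  · obtain ⟨p, hp⟩ := hne
    exact h0 ((hall p (hsub hp)).1 hp)

end ChainData

/-! ### Rows of the simulated system and their growth -/

namespace TileSystem

variable {T G : Type*} {Γ : TileSystem T G}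

/-- A tile of type `t` can be attached to the east of a tile of type `s`. -/
def Joins (Γ : TileSystem T G) (s t : T) : Prop :=
  Γ.glue s .east = Γ.glue t .west ∧ Γ.temperature ≤ Γ.str (Γ.glue s .east)

variable {A : Assembly T} {x₀ : ℤ} {q : ℤ × ℤ} {a s t : T}

theorem temperature_le_bondWith_west :
    Γ.temperature ≤ bondWith Γ.glue Γ.str t .west (some s) ↔ Γ.Joins s t := by
  have := Γ.temperature_pos
  rw [bondWith_some, Joins]
  by_cases h : Γ.glue t .west = Γ.glue s Side.west.opp
  · rw [if_pos h, h]; exact ⟨fun h' => ⟨rfl, h'⟩, fun h' => h'.2⟩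
  · rw [if_neg h]
    exact ⟨fun h' => by omega, fun h' => absurd h'.1.symm h⟩

theorem temperature_le_bondWith_east :
    Γ.temperature ≤ bondWith Γ.glue Γ.str s .east (some t) ↔ Γ.Joins s t := by
  have := Γ.temperature_pos
  rw [bondWith_some, Joins]
  by_cases h : Γ.glue s .east = Γ.glue t Side.east.opp
  · rw [if_pos h]; exact ⟨fun h' => ⟨h, h'⟩, fun h' => h'.2⟩
  · rw [if_neg h]
    exact ⟨fun h' => by omega, fun h' => absurd h'.1 h⟩

/-- The cut of the row between the columns `x` and `x + 1` meets a single bond, so stability forces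
that bond to reach the temperature. -/
theorem joins_of_stable
    (hA : ∀ p, A.cell p ≠ none ↔ p.2 = q.2 ∧ x₀ ≤ p.1 ∧ p.1 < q.1)
    (hst : A.Stable Γ.glue Γ.str Γ.temperature) {x : ℤ}
    (hs : A.cell (x, q.2) = some s) (ht : A.cell (x + 1, q.2) = some t) : Γ.Joins s t := by
  classical
  have h1 : (x, q.2) ∈ A.dom := by rw [mem_dom, hs]; simp
  have h2 : (x + 1, q.2) ∈ A.dom := by rw [mem_dom, ht]; simp
  have hcut := hst (A.dom.filter fun p => p.1 ≤ x) (Finset.filter_subset _ _)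
    ⟨(x, q.2), by simp [h1]⟩ (fun h => by rw [← h] at h2; simp at h2)
  have hv : ((x, q.2) : ℤ × ℤ) + Side.east.vec = (x + 1, q.2) := by simp [Side.vec]
  have hzero : ∀ p ∈ A.dom, ∀ p' ∈ A.dom, p.1 ≤ x → ¬ p'.1 ≤ x → (p ≠ (x, q.2) ∨ p' ≠ (x + 1, q.2)) →
      A.bond Γ.glue Γ.str p p' = 0 := by
    intro p hp p' hp' hx hx' hne
    have r1 := (hA p).1 (mem_dom.1 hp)
    have r2 := (hA p').1 (mem_dom.1 hp')
    unfold bond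
    split
    · refine Finset.sum_eq_zero fun d _ => if_neg ?_
      rintro ⟨rfl, -⟩
      have e1 : p = (x, q.2) ∧ d = .east := by
        obtain ⟨u, v⟩ := p
        cases d <;> simp [Side.vec] at * <;> omega
      obtain ⟨rfl, rfl⟩ := e1
      simp [Side.vec] at hne
    · rfl
  rw [Finset.sum_eq_single (x, q.2), Finset.sum_eq_single (x + 1, q.2), ← hv,
    bond_add_vec _ _ hs (hv ▸ ht)] at hcut
  · exact temperature_le_bondWith_east.1 hcut
  · intro p' hp' hne
    simp only [Finset.mem_sdiff, Finset.mem_filter, not_and] at hp'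
    exact hzero _ h1 _ hp'.1 le_rfl (hp'.2 hp'.1) (Or.inr hne)
  · intro h
    simp [h2] at h
  · intro p hp hne
    simp only [Finset.mem_filter] at hp
    refine Finset.sum_eq_zero fun p' hp' => ?_
    simp only [Finset.mem_sdiff, Finset.mem_filter, not_and] at hp'
    exact hzero _ hp.1 _ hp'.1 hp.2 (hp'.2 hp'.1) (Or.inl hne)
  · intro h
    simp [h1] at h

theorem attachWeight_east_end (hA : IsRow A x₀ q a s) :
    A.attachWeight Γ.glue Γ.str q t = bondWith Γ.glue Γ.str t .west (some s) := by
  have hnone : ∀ p : ℤ × ℤ, ¬(p.2 = q.2 ∧ x₀ ≤ p.1 ∧ p.1 < q.1) → A.cell p = none := fun p hp => by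
    by_contra h; exact hp ((hA.cell_ne p).1 h)
  have hw : q + Side.west.vec = (q.1 - 1, q.2) := by ext <;> simp [Side.vec]; ring
  rw [attachWeight, Side.sum_eq, hw, hA.last, hnone (q + Side.north.vec) (by simp [Side.vec]),
    hnone (q + Side.east.vec) (by simp [Side.vec]), hnone (q + Side.south.vec) (by simp [Side.vec])]
  simp [bondWith_none]

theorem attachWeight_west_end (hA : IsRow A x₀ q a s) :
    A.attachWeight Γ.glue Γ.str (x₀ - 1, q.2) t = bondWith Γ.glue Γ.str t .east (some a) := by
  have hnone : ∀ p : ℤ × ℤ, ¬(p.2 = q.2 ∧ x₀ ≤ p.1 ∧ p.1 < q.1) → A.cell p = none := fun p hp => by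
    by_contra h; exact hp ((hA.cell_ne p).1 h)
  have hw : ((x₀ - 1, q.2) : ℤ × ℤ) + Side.east.vec = (x₀, q.2) := by ext <;> simp [Side.vec]
  rw [attachWeight, Side.sum_eq, hw, hA.first, hnone (_ + Side.north.vec) (by simp [Side.vec]),
    hnone (_ + Side.west.vec) (by simp [Side.vec]), hnone (_ + Side.south.vec) (by simp [Side.vec])]
  simp [bondWith_none]

/-- The enlarged assembly is again producible, hence a line, and an interval extended by one cell
can only be extended at an end. -/
theorem IsUnidirectionalTwoChoiceLinear.end_of_mem_frontier
    (hΓ : Γ.IsUnidirectionalTwoChoiceLinear) (hA : IsRow A x₀ q a s) (hp : Γ.Producible A)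
    {p : ℤ × ℤ} (hf : (p, t) ∈ Γ.frontier A) : p = q ∨ p = (x₀ - 1, q.2) := by
  obtain ⟨n, x, y, hl⟩ := hΓ.linear _ (hp.attach hf)
  have hx : x₀ < q.1 := by
    have := (hA.cell_ne _).1 (by rw [hA.first]; simp)
    exact this.2.2
  have hl' : ∀ p', (p' = p ∨ (p'.2 = q.2 ∧ x₀ ≤ p'.1 ∧ p'.1 < q.1)) ↔
      p'.2 = y ∧ x ≤ p'.1 ∧ p'.1 < x + n := by
    intro p'
    rw [← hl, dom_place, Finset.mem_insert, mem_dom, hA.cell_ne]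
  have hpn : ¬(p.2 = q.2 ∧ x₀ ≤ p.1 ∧ p.1 < q.1) := fun h => (hA.cell_ne p).2 h hf.1
  have h1 := (hl' p).1 (Or.inl rfl)
  have h2 := hl' (x₀, q.2)
  have h3 := hl' (x₀ - 1, q.2)
  have h4 := hl' q
  have h5 := hl' (q.1 - 1, q.2)
  obtain ⟨u, v⟩ := p
  obtain ⟨z, w⟩ := q
  simp only [Prod.mk.injEq, true_and, le_refl] at h1 h2 h3 h4 h5 hpn hx ⊢
  omega

/-- The row `A` can only grow at its east end. -/
theorem mem_frontier_iff_joins (hΓ : Γ.IsUnidirectionalTwoChoiceLinear) (hA : IsRow A x₀ q a s)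
    (hp : Γ.Producible A) (ha : ∀ t, ¬ Γ.Joins t a) {p : ℤ × ℤ} :
    (p, t) ∈ Γ.frontier A ↔ p = q ∧ Γ.Joins s t := by
  have hq : A.cell q = none := by
    by_contra h; exact lt_irrefl _ ((hA.cell_ne q).1 h).2.2
  constructor
  · intro hf
    have hw := (hp.mem_frontier_iff.1 hf).2
    rcases hΓ.end_of_mem_frontier hA hp hf with rfl | rfl
    · rw [attachWeight_east_end hA, temperature_le_bondWith_west] at hw
      exact ⟨rfl, hw⟩
    · rw [attachWeight_west_end hA, temperature_le_bondWith_east] at hw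
      exact absurd hw (ha t)
  · rintro ⟨rfl, hj⟩
    rw [hp.mem_frontier_iff, attachWeight_east_end hA, temperature_le_bondWith_west]
    exact ⟨hq, hj⟩

theorem isRow_place (hA : IsRow A x₀ q a s) (t : T) :
    IsRow (A.place q t) x₀ (q + Side.east.vec) a t := by
  have hx : x₀ < q.1 := ((hA.cell_ne _).1 (by rw [hA.first]; simp)).2.2
  refine ⟨?_, ?_, ?_⟩
  · intro p
    rw [← mem_dom, dom_place, Finset.mem_insert, mem_dom, hA.cell_ne]
    obtain ⟨u, v⟩ := p
    obtain ⟨z, w⟩ := q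
    simp [Side.vec] at *
    omega
  · rw [cell_place_of_ne]
    · simpa [Side.vec] using hA.first
    · intro h
      have := congrArg Prod.fst h
      simp only at this
      omega
  · have : ((q + Side.east.vec).1 - 1, (q + Side.east.vec).2) = q := by
      ext <;> simp [Side.vec]
    rw [this, cell_place_self]

/-- The seed is a row that cannot grow at its west end. -/
def IsEastward (Γ : TileSystem T G) : Prop :=
  ∃ x₀ q a s, IsRow Γ.seed x₀ q a s ∧ ∀ t, ¬ Γ.Joins t a

/-- Growth to the east leaves the first tile of the row unchanged, so the obstruction at the west
end of the seed persists. -/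
theorem Producible.isRow (hΓ : Γ.IsUnidirectionalTwoChoiceLinear) (he : Γ.IsEastward)
    (hA : Γ.Producible A) : ∃ x₀ q a s, IsRow A x₀ q a s ∧ ∀ t, ¬ Γ.Joins t a := by
  induction hA with
  | seed => exact he
  | attach hA hf ih =>
    obtain ⟨x₀, q, a, s, hr, ha⟩ := ih
    obtain ⟨rfl, -⟩ := (mem_frontier_iff_joins hΓ hr hA ha).1 hf
    exact ⟨x₀, _, a, _, isRow_place hr _, ha⟩

theorem exists_isRow {A : Assembly T} (hA : A.dom.Nonempty) {n : ℕ} (h : A.IsLine n) :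
    ∃ x₀ q a s, IsRow A x₀ q a s := by
  obtain ⟨x, y, h⟩ := h
  obtain ⟨p, hp⟩ := hA
  have hp' := (h p).1 hp
  obtain ⟨a, ha⟩ := Option.ne_none_iff_exists'.1 (mem_dom.1 ((h (x, y)).2 ⟨rfl, le_rfl, by omega⟩))
  obtain ⟨s, hs⟩ := Option.ne_none_iff_exists'.1
    (mem_dom.1 ((h (x + n - 1, y)).2 ⟨rfl, by simp only; omega, by simp only; omega⟩))
  exact ⟨x, (x + n, y), a, s, fun p => by rw [← mem_dom, h], ha, hs⟩

end TileSystem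

end ATAM

/-! ### Simulation of systems that grow to the east -/

namespace ATAM

open Role Assembly

theorem Assembly.card_dom_blockReplace {T T' : Type*} (R : T → Fin 5 → Fin 4 → T') (A : Assembly T) :
    (A.blockReplace R).dom.card = A.dom.card * 20 := by
  classical
  have h : (A.blockReplace R).dom =
      (A.dom ×ˢ (Finset.univ : Finset Role)).image fun x => blockCell x.1 x.2 := by
    ext p
    rw [← blockCell_surjective p, mem_dom, cell_blockReplace]
    simp only [Finset.mem_image, Finset.mem_product, Finset.mem_univ, and_true, blockCell_inj,
      mem_dom, ne_eq, Option.map_eq_none_iff]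
    constructor
    · exact fun h => ⟨(blockOf p, roleOf p), h, rfl, rfl⟩
    · rintro ⟨⟨q, r⟩, h, rfl, rfl⟩; exact h
  rw [h, Finset.card_image_of_injective, Finset.card_product]
  · rfl
  · rintro ⟨q, r⟩ ⟨q', r'⟩ h
    exact Prod.ext_iff.2 (blockCell_inj.1 h)

theorem ChainData.blockReplace_injective {T K : Type*} (D : ChainData K) {e : T → K}
    (he : Function.Injective e) :
    Function.Injective fun A : Assembly T => A.blockReplace (D.blocks e) := by
  intro A B h
  ext1
  funext q
  have h1 := congrArg (fun A => A.cell (blockCell q (4, 3))) h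
  simp only [cell_blockReplace] at h1
  refine Option.map_injective (fun s t hst => he ?_) h1
  simpa [blocks, block, IsLate] using congrArg Prod.fst hst

namespace TileSystem

variable {T G K : Type*} {Γ : TileSystem T G}

section ChainData

variable [Nonempty T] (Γ) (e : T ≃ K)

open Classical in
/-- The data of the simulation of a system whose assemblies are rows that grow to the east. -/
noncomputable def chainData : ChainData K where
  rep k := e (Function.invFun (fun t => Γ.glue t .west) (Γ.glue (e.symm k) .west))
  next k := if ∃ t, Γ.Joins (e.symm k) t then
    some (e (Function.invFun (fun t => Γ.glue t .west) (Γ.glue (e.symm k) .east))) else none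

variable {Γ e} {s t : T}

theorem glue_rep (k : K) :
    Γ.glue (e.symm ((Γ.chainData e).rep k)) .west = Γ.glue (e.symm k) .west := by
  simp only [chainData, Equiv.symm_apply_apply]
  exact Function.invFun_eq (f := fun t => Γ.glue t .west) ⟨_, rfl⟩

theorem rep_eq_rep_iff :
    (Γ.chainData e).rep (e s) = (Γ.chainData e).rep (e t) ↔ Γ.glue s .west = Γ.glue t .west := by
  constructor
  · intro h
    have hs := glue_rep (Γ := Γ) (e := e) (e s)
    rw [h, glue_rep] at hs
    simpa using hs.symm
  · intro h
    simp [chainData, h]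

theorem rep_rep (k : K) : (Γ.chainData e).rep ((Γ.chainData e).rep k) = (Γ.chainData e).rep k := by
  obtain ⟨t, rfl⟩ := e.surjective k
  have h := glue_rep (Γ := Γ) (e := e) (e t)
  obtain ⟨u, hu⟩ := e.surjective ((Γ.chainData e).rep (e t))
  rw [← hu] at h
  rw [← hu]
  exact (rep_eq_rep_iff.2 (by simpa using h)).trans hu.symm

/-- Both `rep` and `next` choose a tile type as a function of the glue alone, so the same
representative is obtained from the west side of `t` and from the matching east side of `s`. -/
theorem next_eq_some_iff :
    (Γ.chainData e).next (e s) = some ((Γ.chainData e).rep (e t)) ↔ Γ.Joins s t := by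
  have key : ∀ u, Γ.Joins s u → (Γ.chainData e).next (e s) = some ((Γ.chainData e).rep (e u)) := by
    intro u hu
    have hex : ∃ t, Γ.Joins s t := ⟨u, hu⟩
    simp [chainData, hex, hu.1]
  refine ⟨fun h => ?_, key t⟩
  by_cases hex : ∃ u, Γ.Joins s u
  · obtain ⟨u, hu⟩ := hex
    rw [key u hu, Option.some_inj, rep_eq_rep_iff] at h
    exact ⟨hu.1.trans h, hu.2⟩
  · simp [chainData, hex] at h

theorem next_eq_none (h : ∀ t, ¬ Γ.Joins s t) : (Γ.chainData e).next (e s) = none := by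
  simp [chainData, h]

end ChainData

/-- The tile system of the simulation. -/
noncomputable def simulator (D : ChainData K) (e : T → K) (A : Assembly T)
    (hne : (A.blockReplace (D.blocks e)).dom.Nonempty)
    (hst : (A.blockReplace (D.blocks e)).Stable D.glue glueStr 2) :
    TileSystem (K × Role) (ℕ × ℕ × Option K) where
  glue := D.glue
  str := glueStr
  seed := A.blockReplace (D.blocks e)
  temperature := 2
  temperature_pos := by norm_num
  seed_nonempty := hne
  seed_stable := hst

variable [Nonempty T] {e : T ≃ K} {Γs : TileSystem (K × Role) (ℕ × ℕ × Option K)} {A : Assembly T}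

/-- `Γs` has the tile types and the seed that simulate the system `Γ`, whose assemblies are rows
that grow to the east. -/
structure IsSimulation (Γ : TileSystem T G) (e : T ≃ K)
    (Γs : TileSystem (K × Role) (ℕ × ℕ × Option K)) : Prop where
  linear : Γ.IsUnidirectionalTwoChoiceLinear
  eastward : Γ.IsEastward
  sim : (Γ.chainData e).IsSimulator Γs
  seed_eq : Γs.seed = Γ.seed.blockReplace ((Γ.chainData e).blocks e)

namespace IsSimulation

/-- One step of the growth of `Γ`, and its simulation. -/
theorem step_cases [Fintype K] (h : IsSimulation Γ e Γs) (hA : Γ.Producible A)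
    (hA' : Γs.Producible (A.blockReplace ((Γ.chainData e).blocks e))) :
    (Γ.frontier A = ∅ ∧ Γs.frontier (A.blockReplace ((Γ.chainData e).blocks e)) = ∅) ∨
    (∃ p u, Γ.frontier A = {(p, u)} ∧
      Γs.Producible ((A.place p u).blockReplace ((Γ.chainData e).blocks e)) ∧
      ∀ C X, Γs.frontier X = ∅ → Γs.hit C X (A.blockReplace ((Γ.chainData e).blocks e)) =
        Γs.hit C X ((A.place p u).blockReplace ((Γ.chainData e).blocks e))) ∨
    (∃ p u v, u ≠ v ∧ Γ.frontier A = {(p, u), (p, v)} ∧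
      Γs.Producible ((A.place p u).blockReplace ((Γ.chainData e).blocks e)) ∧
      Γs.Producible ((A.place p v).blockReplace ((Γ.chainData e).blocks e)) ∧
      ∀ C X, Γs.frontier X = ∅ → Γs.hit C X (A.blockReplace ((Γ.chainData e).blocks e)) =
        2⁻¹ * Γs.hit C X ((A.place p u).blockReplace ((Γ.chainData e).blocks e)) +
        2⁻¹ * Γs.hit C X ((A.place p v).blockReplace ((Γ.chainData e).blocks e))) := by
  obtain ⟨x₀, q, a, s, hr, ha⟩ := hA.isRow h.linear h.eastward
  have hf : ∀ {p t}, (p, t) ∈ Γ.frontier A ↔ p = q ∧ Γ.Joins s t :=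
    mem_frontier_iff_joins h.linear hr hA ha
  have hg : (Γ.chainData e).IsGrowing Γs e A q s := by
    refine ⟨h.sim, x₀, a, hr, fun k hk => ?_⟩
    obtain ⟨t, rfl⟩ := e.surjective k
    exact ha t (next_eq_some_iff.1 hk)
  by_cases hex : ∃ t, Γ.Joins s t
  swap
  · push Not at hex
    refine Or.inl ⟨?_, ChainData.frontier_eq_empty_of_next_eq_none hg (next_eq_none hex) hA'⟩
    refine Set.eq_empty_of_forall_notMem fun x hx => hex x.2 (hf.1 hx).2
  right
  obtain ⟨t, ht⟩ := hex
  obtain ⟨u, hu⟩ := e.surjective ((Γ.chainData e).rep (e t))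
  have hs := next_eq_some_iff (e := e).2 ht
  have hrep : (Γ.chainData e).rep (e u) = e u := by rw [hu, rep_rep]
  rw [← hu] at hs
  have hju : Γ.Joins s u := by rw [← next_eq_some_iff (e := e), hrep, hs]
  have hj : ∀ v, (Γ.chainData e).rep (e v) = e u → Γ.Joins s v := fun v hv => by
    rw [← next_eq_some_iff (e := e), hv, hs]
  -- The producibility claims come bundled with probabilities, so extracting them requires some
  -- distribution.
  have hC : Nonempty (Concentration (K × Role)) := by
    have : Nonempty (K × Role) := ⟨(e t, (0, 0))⟩
    exact ⟨Concentration.uniform _⟩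
  by_cases hpair : (Γ.chainData e).Paired (e u)
  · right
    obtain ⟨k, hk, hkr⟩ := hpair
    obtain ⟨v, rfl⟩ := e.surjective k
    have huv : u ≠ v := by rintro rfl; exact hk rfl
    -- Two attachments are known, and the two-choice condition excludes further ones. This also
    -- yields the uniqueness of the partner `v`.
    have hF : Γ.frontier A = {(q, u), (q, v)} := by
      refine (Set.Finite.eq_of_subset_of_encard_le (Set.toFinite _) ?_ ?_).symm
      · rintro x (rfl | rfl)
        · exact hf.2 ⟨rfl, hju⟩
        · exact hf.2 ⟨rfl, hj v hkr⟩
      · rw [Set.encard_pair (by simpa using huv)]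
        exact h.linear.two_choice A hA
    have huniq : ∀ k, (Γ.chainData e).rep k = e u → k = e u ∨ k = e v := by
      intro k hk'
      obtain ⟨w, rfl⟩ := e.surjective k
      have hw : (q, w) ∈ Γ.frontier A := hf.2 ⟨rfl, hj w hk'⟩
      rw [hF] at hw
      simpa using hw
    have key := fun C X => ChainData.hit_of_paired (C := C) (X := X) hg hs hrep hkr hk huniq hA'
    obtain ⟨C⟩ := hC
    exact ⟨q, u, v, huv, hF, (key C (A.blockReplace ((Γ.chainData e).blocks e))).1,
      (key C (A.blockReplace ((Γ.chainData e).blocks e))).2.1, fun C X => (key C X).2.2⟩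
  · left
    have hF : Γ.frontier A = {(q, u)} := by
      ext ⟨p, w⟩
      rw [hf, Set.mem_singleton_iff]
      refine ⟨fun ⟨hpq, hw⟩ => ?_, fun hw => ?_⟩
      swap
      · obtain ⟨rfl, rfl⟩ := Prod.mk.inj hw
        exact ⟨rfl, hju⟩
      refine Prod.ext hpq ?_
      by_contra hne
      refine hpair ⟨e w, by simpa using hne, ?_⟩
      have := next_eq_some_iff (e := e).2 hw
      rw [hs] at this
      exact (Option.some.inj this).symm
    have key := fun C X => ChainData.hit_of_not_paired (C := C) (X := X) hg hs hrep hpair hA'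
    obtain ⟨C⟩ := hC
    exact ⟨q, u, hF, (key C (A.blockReplace ((Γ.chainData e).blocks e))).1, fun C X => (key C X).2⟩

variable [Fintype K]

theorem producible_blockReplace (hsim : IsSimulation Γ e Γs) (hA : Γ.Producible A) :
    Γs.Producible (A.blockReplace ((Γ.chainData e).blocks e)) := by
  induction hA with
  | seed => rw [← hsim.seed_eq]; exact Producible.seed
  | attach hA hf ih =>
    rcases hsim.step_cases hA ih with ⟨h, -⟩ | ⟨p, u, h, h1, -⟩ | ⟨p, u, v, -, h, h1, h2, -⟩
    · rw [h] at hf; exact hf.elim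
    · rw [h] at hf
      obtain ⟨rfl, rfl⟩ := Prod.mk.inj hf
      exact h1
    · rw [h] at hf
      rcases hf with hf | hf
      · obtain ⟨rfl, rfl⟩ := Prod.mk.inj hf
        exact h1
      · obtain ⟨rfl, rfl⟩ := Prod.mk.inj hf
        exact h2

theorem terminal_blockReplace (hsim : IsSimulation Γ e Γs) (hA : A ∈ Γ.terminal) :
    A.blockReplace ((Γ.chainData e).blocks e) ∈ Γs.terminal := by
  have h := hsim.producible_blockReplace hA.1
  refine ⟨h, ?_⟩
  rcases hsim.step_cases hA.1 h with ⟨-, h'⟩ | ⟨p, u, h', -⟩ | ⟨p, u, v, -, h', -⟩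
  · exact h'
  · exact absurd (h'.symm.trans hA.2) (Set.singleton_ne_empty _)
  · exact absurd (h'.symm.trans hA.2) (Set.insert_nonempty _ _).ne_empty

/-- Both sides satisfy the same recursion. At a branching, the uniform distribution gives `2⁻¹` in
`Γ` and the coin gives `2⁻¹` in the simulator, for every `C`. -/
theorem hit_blockReplace [Fintype T] (hsim : IsSimulation Γ e Γs) (C : Concentration (K × Role)) {Y : Assembly T}
    (hY : Y ∈ Γ.terminal) (hA : Γ.Producible A) :
    Γ.hit (Concentration.uniform T) Y A =
      Γs.hit C (Y.blockReplace ((Γ.chainData e).blocks e))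
        (A.blockReplace ((Γ.chainData e).blocks e)) := by
  -- Downward induction on the size of `A`, as assemblies larger than `Y` never reach it.
  obtain ⟨n, hn⟩ : ∃ n, Y.dom.card + 1 ≤ A.dom.card + n := ⟨Y.dom.card + 1, by omega⟩
  have hY' := (hsim.terminal_blockReplace hY).2
  induction n generalizing A with
  | zero =>
    rw [hit_eq_zero_of_card_lt (by omega), hit_eq_zero_of_card_lt]
    rw [card_dom_blockReplace, card_dom_blockReplace]
    omega
  | succ n ih =>
    have ih' : ∀ p t, (p, t) ∈ Γ.frontier A → _ := fun p t hf => ih (hA.attach hf)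
      (by rw [card_dom_place _ hf.1]; omega)
    rcases hsim.step_cases hA (hsim.producible_blockReplace hA) with
      ⟨h, h'⟩ | ⟨p, u, h, -, h'⟩ | ⟨p, u, v, huv, h, -, -, h'⟩
    · by_cases hAY : A = Y
      · subst hAY
        rw [hit_self_of_terminal h, hit_self_of_terminal h']
      · rw [hit_of_terminal h hAY, hit_of_terminal h']
        exact fun heq => hAY ((Γ.chainData e).blockReplace_injective e.injective heq)
    · rw [hit_eq_step hY.2 (by rw [h]; exact Set.singleton_nonempty _), step_singleton h, h' C _ hY',
        ih' p u (by rw [h]; rfl)]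
    · rw [hit_eq_step hY.2 (by rw [h]; exact Set.insert_nonempty _ _),
        step_pair (by simpa using huv) h, h' C _ hY', ih' p u (by rw [h]; exact Or.inl rfl),
        ih' p v (by rw [h]; exact Or.inr rfl)]
      have hc := div_add_self_eq ((Concentration.uniform T).conc_pos u)
      have hcv : (Concentration.uniform T).conc v = (Concentration.uniform T).conc u := rfl
      dsimp only
      rw [hcv, hc]

/-- Otherwise the recursion along `Γ` would give hitting probability zero for `X` from the seed,
although `X` is producible. The producible assemblies of the simulator thus need not be classified.
-/
theorem exists_of_terminal (hsim : IsSimulation Γ e Γs) {X : Assembly (K × Role)} (hX : X ∈ Γs.terminal) :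
    ∃ A ∈ Γ.terminal, A.blockReplace ((Γ.chainData e).blocks e) = X := by
  by_contra hcon
  push Not at hcon
  obtain ⟨t⟩ := ‹Nonempty T›
  have : Nonempty (K × Role) := ⟨(e t, (0, 0))⟩
  suffices ∀ n A, Γ.Producible A → X.dom.card + 1 ≤ A.dom.card * 20 + n →
      Γs.hit (Concentration.uniform (K × Role)) X (A.blockReplace ((Γ.chainData e).blocks e)) = 0 by
    refine hit_ne_zero_of_producible (P := Concentration.uniform (K × Role)) hX.1 ?_
    rw [hsim.seed_eq]
    exact this (X.dom.card + 1) _ Producible.seed (by omega)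
  intro n
  induction n with
  | zero =>
    intro A hA h
    apply hit_eq_zero_of_card_lt
    rw [card_dom_blockReplace]
    omega
  | succ n ih =>
    intro A hA hn
    have ih' : ∀ p t, (p, t) ∈ Γ.frontier A → _ := fun p t hf => ih _ (hA.attach hf)
      (by rw [card_dom_place _ hf.1]; omega)
    rcases hsim.step_cases hA (hsim.producible_blockReplace hA) with
      ⟨h, h'⟩ | ⟨p, u, h, -, h'⟩ | ⟨p, u, v, huv, h, -, -, h'⟩
    · exact hit_of_terminal h' (hcon A ⟨hA, h⟩)
    · rw [h' _ _ hX.2, ih' p u (by rw [h]; rfl)]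
    · rw [h' _ _ hX.2, ih' p u (by rw [h]; exact Or.inl rfl), ih' p v (by rw [h]; exact Or.inr rfl)]
      simp

theorem robustlySimulates [Fintype T] (hsim : IsSimulation Γ e Γs) :
    Γs.RobustlySimulates Γ (Concentration.uniform T) 5 4 := by
  refine ⟨(Γ.chainData e).blocks e, ⟨?_, ?_, ?_⟩, ?_⟩
  · exact fun A hA => hsim.terminal_blockReplace hA
  · exact ((Γ.chainData e).blockReplace_injective e.injective).injOn
  · intro X hX
    exact hsim.exists_of_terminal hX
  · intro A hA C
    rw [termProb_eq_hit, termProb_eq_hit, hsim.hit_blockReplace C hA Producible.seed, hsim.seed_eq]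

end IsSimulation

theorem exists_robustlySimulates_of_isEastward [Fintype T] (hΓ : Γ.IsUnidirectionalTwoChoiceLinear)
    (he : Γ.IsEastward) :
    ∃ (T' G' : Type) (_ : Fintype T') (Γs : TileSystem T' G'),
      Fintype.card T' = 20 * Fintype.card T ∧
      Γs.RobustlySimulates Γ (Concentration.uniform T) 5 4 := by
  let e := Fintype.equivFin T
  obtain ⟨x₀, q, a, s, hr, -⟩ := id he
  have hst : (Γ.seed.blockReplace ((Γ.chainData e).blocks e)).Stable (Γ.chainData e).glue glueStr 2 :=
    ChainData.stable_blockReplace hr.cell_ne fun x s t hs ht =>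
      next_eq_some_iff.2 (joins_of_stable hr.cell_ne Γ.seed_stable hs ht)
  have hne : (Γ.seed.blockReplace ((Γ.chainData e).blocks e)).dom.Nonempty := by
    rw [← Finset.card_pos, card_dom_blockReplace]
    have := Finset.card_pos.2 Γ.seed_nonempty
    omega
  refine ⟨Fin (Fintype.card T) × Role, _, inferInstance,
    simulator (Γ.chainData e) e Γ.seed hne hst, ?_,
    IsSimulation.robustlySimulates (e := e) ⟨hΓ, he, ⟨rfl, rfl, rfl⟩, rfl⟩⟩
  simp [Fintype.card_prod]
  ring

end TileSystem

end ATAM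

/-! ### Reflection, and the reduction to growth to the east -/

namespace ATAM

/-- The reflection that maps the cell `(0, y)` to the cell `(-1, y)`. -/
def mirrorCell (p : ℤ × ℤ) : ℤ × ℤ := (-1 - p.1, p.2)

theorem mirrorCell_mirrorCell (p : ℤ × ℤ) : mirrorCell (mirrorCell p) = p := by
  ext <;> simp [mirrorCell]

theorem mirrorCell_involutive : Function.Involutive mirrorCell := mirrorCell_mirrorCell

/-- The reflection of a side. -/
def Side.mirror : Side → Side
  | .north => .north
  | .east => .west
  | .south => .south
  | .west => .east

theorem Side.mirror_mirror (d : Side) : d.mirror.mirror = d := by cases d <;> rfl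

theorem Side.mirror_opp (d : Side) : d.opp.mirror = d.mirror.opp := by cases d <;> rfl

theorem mirrorCell_add_vec (p : ℤ × ℤ) (d : Side) :
    mirrorCell (p + d.vec) = mirrorCell p + d.mirror.vec := by
  cases d <;> ext <;> simp [mirrorCell, Side.vec, Side.mirror] <;> ring

namespace Assembly

variable {T G : Type*}

/-- The reflection of an assembly. -/
def mirror (A : Assembly T) : Assembly T where
  cell p := A.cell (mirrorCell p)
  finite_cells := A.finite_cells.preimage mirrorCell_involutive.injective.injOn

theorem mirror_mirror (A : Assembly T) : A.mirror.mirror = A := by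
  ext1
  funext p
  simp [mirror, mirrorCell_mirrorCell]

theorem mirror_injective : Function.Injective (mirror : Assembly T → Assembly T) :=
  Function.Involutive.injective mirror_mirror

theorem mem_dom_mirror {A : Assembly T} {p : ℤ × ℤ} : p ∈ A.mirror.dom ↔ mirrorCell p ∈ A.dom := by
  rw [mem_dom, mem_dom]; rfl

theorem mirror_place (A : Assembly T) (p : ℤ × ℤ) (t : T) :
    (A.place p t).mirror = A.mirror.place (mirrorCell p) t := by
  ext1
  funext q
  by_cases h : q = mirrorCell p
  · subst h
    rw [cell_place_self]
    simp [mirror, mirrorCell_mirrorCell, place]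
  · rw [cell_place_of_ne _ _ h]
    refine cell_place_of_ne _ _ fun h' => h ?_
    rw [← h', mirrorCell_mirrorCell]

theorem bond_mirror (glue : T → Side → G) (str : G → ℕ) (A : Assembly T) (p q : ℤ × ℤ) :
    A.mirror.bond (fun t d => glue t d.mirror) str p q =
      A.bond glue str (mirrorCell p) (mirrorCell q) := by
  classical
  unfold bond
  simp only [mirror]
  rcases A.cell (mirrorCell p) with _ | a <;> rcases A.cell (mirrorCell q) with _ | b <;>
    simp only
  refine Finset.sum_nbij' Side.mirror Side.mirror (by simp) (by simp)
    (fun d _ => d.mirror_mirror) (fun d _ => d.mirror_mirror) ?_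
  intro d _
  rw [Side.mirror_opp, ← mirrorCell_add_vec]
  simp only [mirrorCell_involutive.injective.eq_iff]

theorem Stable.mirror {glue : T → Side → G} {str : G → ℕ} {τ : ℕ} {A : Assembly T}
    (h : A.Stable glue str τ) : A.mirror.Stable (fun t d => glue t d.mirror) str τ := by
  classical
  intro S hS hne hneq
  have hinj := mirrorCell_involutive.injective
  have hdom : A.dom = A.mirror.dom.image mirrorCell := by
    ext p
    simp only [Finset.mem_image, mem_dom_mirror]
    exact ⟨fun hp => ⟨mirrorCell p, by rwa [mirrorCell_mirrorCell], mirrorCell_mirrorCell p⟩,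
      by rintro ⟨q, hq, rfl⟩; exact hq⟩
  have := h (S.image mirrorCell) (by rw [hdom]; exact Finset.image_subset_image hS) (hne.image _)
    (by rw [hdom]; exact fun he => hneq (Finset.image_injective hinj he))
  rw [hdom, ← Finset.image_sdiff _ _ hinj, Finset.sum_image hinj.injOn] at this
  simp only [Finset.sum_image hinj.injOn] at this
  simpa only [bond_mirror] using this

theorem IsLine.mirror {A : Assembly T} {n : ℕ} (h : A.IsLine n) : A.mirror.IsLine n := by
  obtain ⟨x, y, h⟩ := h
  refine ⟨-x - n, y, fun p => ?_⟩
  rw [mem_dom_mirror, h]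
  simp only [mirrorCell]
  omega

/-- This is why the reflection is `x ↦ -1 - x`: it maps blocks onto blocks and reverses the columns
within each. -/
theorem mirrorCell_blockCell (q : ℤ × ℤ) (r : Role) :
    mirrorCell (blockCell q r) = blockCell (mirrorCell q) (r.1.rev, r.2) := by
  obtain ⟨i, j⟩ := r
  simp only [mirrorCell, blockCell, Fin.val_rev, Prod.mk.injEq, and_true]
  omega

theorem mirror_blockReplace {T' : Type*} (R : T → Fin 5 → Fin 4 → T') (A : Assembly T) :
    (A.blockReplace R).mirror = A.mirror.blockReplace fun t i j => R t i.rev j := by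
  refine ext_blockCell fun q r => ?_
  rw [cell_blockReplace]
  simp only [mirror, mirrorCell_blockCell, cell_blockReplace]

end Assembly

namespace TileSystem

variable {T G : Type*}

/-- The reflection of a tile system. -/
def mirror (Γ : TileSystem T G) : TileSystem T G where
  glue t d := Γ.glue t d.mirror
  str := Γ.str
  seed := Γ.seed.mirror
  temperature := Γ.temperature
  temperature_pos := Γ.temperature_pos
  seed_nonempty := by
    obtain ⟨p, hp⟩ := Γ.seed_nonempty
    exact ⟨mirrorCell p, by rwa [Assembly.mem_dom_mirror, mirrorCell_mirrorCell]⟩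
  seed_stable := Γ.seed_stable.mirror

variable {Γ : TileSystem T G} {A : Assembly T}

theorem mem_frontier_mirror {p : ℤ × ℤ} {t : T} (h : (p, t) ∈ Γ.frontier A) :
    (mirrorCell p, t) ∈ Γ.mirror.frontier A.mirror := by
  obtain ⟨h1, h2⟩ := h
  refine ⟨?_, ?_⟩
  · simpa [Assembly.mirror, mirrorCell_mirrorCell] using h1
  · have := h2.mirror
    rwa [Assembly.mirror_place] at this

theorem mirror_mirror (Γ : TileSystem T G) : Γ.mirror.mirror = Γ := by
  cases Γ
  simp [mirror, Side.mirror_mirror, Assembly.mirror_mirror]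

theorem frontier_mirror :
    Γ.mirror.frontier A.mirror = (fun b => (mirrorCell b.1, b.2)) '' Γ.frontier A := by
  ext ⟨p, t⟩
  constructor
  · intro h
    have := mem_frontier_mirror h
    rw [mirror_mirror, Assembly.mirror_mirror] at this
    exact ⟨_, this, by simp [mirrorCell_mirrorCell]⟩
  · rintro ⟨⟨p', t'⟩, h, heq⟩
    obtain ⟨rfl, rfl⟩ := Prod.mk.inj heq
    exact mem_frontier_mirror h

theorem Producible.mirror (h : Γ.Producible A) : Γ.mirror.Producible A.mirror := by
  induction h with
  | seed => exact Producible.seed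
  | attach _ hf ih =>
    rw [Assembly.mirror_place]
    exact ih.attach (mem_frontier_mirror hf)

theorem terminal_mirror (h : A ∈ Γ.terminal) : A.mirror ∈ Γ.mirror.terminal :=
  ⟨h.1.mirror, by rw [frontier_mirror, h.2, Set.image_empty]⟩

theorem mirror_mem_terminal_iff : A.mirror ∈ Γ.mirror.terminal ↔ A ∈ Γ.terminal := by
  refine ⟨fun h => ?_, terminal_mirror⟩
  have := terminal_mirror h
  rwa [mirror_mirror, Assembly.mirror_mirror] at this

theorem IsUnidirectionalTwoChoiceLinear.mirror (h : Γ.IsUnidirectionalTwoChoiceLinear) :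
    Γ.mirror.IsUnidirectionalTwoChoiceLinear := by
  have key : ∀ A, Γ.mirror.Producible A → ∃ B, Γ.Producible B ∧ A = B.mirror := by
    intro A hA
    have := hA.mirror
    rw [mirror_mirror] at this
    exact ⟨_, this, A.mirror_mirror.symm⟩
  refine ⟨?_, ?_, ?_⟩
  · intro A hA
    obtain ⟨B, hB, rfl⟩ := key A hA
    rw [frontier_mirror, Set.image_image]
    have := (Set.encard_image_le mirrorCell (Prod.fst '' Γ.frontier B)).trans (h.extensible B hB)
    rwa [Set.image_image] at this
  · intro A hA
    obtain ⟨B, hB, rfl⟩ := key A hA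
    rw [frontier_mirror]
    exact (Set.encard_image_le _ _).trans (h.two_choice B hB)
  · intro A hA
    obtain ⟨B, hB, rfl⟩ := key A hA
    obtain ⟨n, hn⟩ := h.linear B hB
    exact ⟨n, hn.mirror⟩

section Probability

variable [Fintype T] (P : Concentration T)

theorem step_mirror (f : Assembly T → ℝ≥0∞) :
    Γ.mirror.step P f A.mirror = Γ.step P (fun B => f B.mirror) A := by
  have hinj : Function.Injective fun b : (ℤ × ℤ) × T => (mirrorCell b.1, b.2) := by
    rintro ⟨p, t⟩ ⟨p', t'⟩ h
    obtain ⟨h1, h2⟩ := Prod.mk.inj h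
    exact Prod.ext (mirrorCell_involutive.injective h1) h2
  unfold step
  rw [frontier_mirror,
    tsum_image (fun b : (ℤ × ℤ) × T => (P.conc b.2 : ℝ≥0∞) * f (A.mirror.place b.1 b.2)) hinj.injOn,
    tsum_image (fun b : (ℤ × ℤ) × T => (P.conc b.2 : ℝ≥0∞)) hinj.injOn]
  simp only [Assembly.mirror_place]

theorem walk_mirror (X : Assembly T) (n : ℕ) :
    Γ.mirror.walk P X.mirror n A.mirror = Γ.walk P X n A := by
  induction n generalizing A with
  | zero =>
    simp only [walk]
    by_cases h : A = X
    · rw [if_pos h, if_pos (congrArg _ h)]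
    · rw [if_neg h, if_neg (Assembly.mirror_injective.ne h)]
  | succ n ih =>
    simp only [walk]
    rw [step_mirror]
    congr 1
    funext B
    exact ih

theorem termProb_mirror (X : Assembly T) : Γ.mirror.termProb P X.mirror = Γ.termProb P X := by
  rw [termProb_eq_hit, termProb_eq_hit]
  exact tsum_congr fun n => walk_mirror P X n

theorem RobustlySimulates.mirror {T₀ G₀ : Type*} [Fintype T₀] {Γ₀ : TileSystem T₀ G₀}
    {P : Concentration T₀} (h : Γ.RobustlySimulates Γ₀.mirror P 5 4) :
    Γ.mirror.RobustlySimulates Γ₀ P 5 4 := by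
  obtain ⟨R, hbij, hprob⟩ := h
  have hR : ∀ A : Assembly T₀, A.blockReplace (fun t i j => R t (Fin.rev i) j) =
      (A.mirror.blockReplace R).mirror := by
    intro A
    rw [Assembly.mirror_blockReplace, Assembly.mirror_mirror]
  refine ⟨fun t i j => R t i.rev j, ⟨?_, ?_, ?_⟩, ?_⟩
  · intro A hA
    rw [hR]
    exact terminal_mirror (hbij.mapsTo (terminal_mirror hA))
  · intro A hA B hB heq
    simp only [hR] at heq
    exact Assembly.mirror_injective (hbij.injOn (terminal_mirror hA) (terminal_mirror hB)
      (Assembly.mirror_injective heq))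
  · intro X hX
    rw [← X.mirror_mirror, mirror_mem_terminal_iff] at hX
    obtain ⟨A, hA, hAX⟩ := hbij.surjOn hX
    rw [← A.mirror_mirror, mirror_mem_terminal_iff] at hA
    refine ⟨A.mirror, hA, ?_⟩
    rw [hR, Assembly.mirror_mirror, hAX, Assembly.mirror_mirror]
  · intro A hA C
    rw [hR, termProb_mirror, ← termProb_mirror, hprob _ (terminal_mirror hA)]

end Probability

/-- If the seed could grow at both ends, its frontier would meet two locations, contrary to
1-extensibility. -/
theorem isEastward_or_isEastward_mirror (hΓ : Γ.IsUnidirectionalTwoChoiceLinear) :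
    Γ.IsEastward ∨ Γ.mirror.IsEastward := by
  obtain ⟨n, hn⟩ := hΓ.linear _ Producible.seed
  obtain ⟨x₀, q, a, s, hr⟩ := exists_isRow Γ.seed_nonempty hn
  by_cases ha : ∀ t, ¬ Γ.Joins t a
  · exact Or.inl ⟨x₀, q, a, s, hr, ha⟩
  right
  push Not at ha
  obtain ⟨u, hu⟩ := ha
  have hx : x₀ < q.1 := ((hr.cell_ne _).1 (by rw [hr.first]; simp)).2.2
  have hs : ∀ t, ¬ Γ.Joins s t := by
    intro t ht
    have h1 : (q, t) ∈ Γ.frontier Γ.seed := by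
      rw [Producible.seed.mem_frontier_iff, attachWeight_east_end hr, temperature_le_bondWith_west]
      refine ⟨?_, ht⟩
      by_contra h; exact lt_irrefl _ ((hr.cell_ne q).1 h).2.2
    have h2 : ((x₀ - 1, q.2), u) ∈ Γ.frontier Γ.seed := by
      rw [Producible.seed.mem_frontier_iff, attachWeight_west_end hr, temperature_le_bondWith_east]
      refine ⟨?_, hu⟩
      by_contra h
      have := ((hr.cell_ne _).1 h).2.1
      simp only at this
      omega
    have := Set.encard_le_one_iff.1 (hΓ.extensible _ Producible.seed) _ _ ⟨_, h1, rfl⟩ ⟨_, h2, rfl⟩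
    have := congrArg Prod.fst this
    simp only at this
    omega
  -- The columns from `x₀` to `q.1 - 1` are reflected to those from `-q.1` to `-x₀ - 1`, so the cell
  -- after the row has column `-x₀`, and the first and last tiles are exchanged.
  refine ⟨-q.1, (-x₀, q.2), s, a, ⟨?_, ?_, ?_⟩, ?_⟩
  · intro p
    refine (hr.cell_ne (mirrorCell p)).trans ?_
    simp only [mirrorCell]
    omega
  · refine Eq.trans (congrArg Γ.seed.cell ?_) hr.last
    simp [mirrorCell]
    ring
  · refine Eq.trans (congrArg Γ.seed.cell ?_) hr.first
    simp [mirrorCell]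
    ring
  · rintro t ⟨h1, h2⟩
    refine hs t ⟨h1.symm, ?_⟩
    rw [h1] at h2
    exact h2

end TileSystem

end ATAM

theorem mainTheorem3 {T G : Type*} [Fintype T] [Nonempty T] (Γ : ATAM.TileSystem T G)
    (hτ : Γ.temperature = 2) (hΓ : Γ.IsUnidirectionalTwoChoiceLinear) :
    ∃ (T' G' : Type) (_ : Fintype T') (Γs : ATAM.TileSystem T' G'),
      Fintype.card T' = 20 * Fintype.card T ∧
      Γs.RobustlySimulates Γ (ATAM.Concentration.uniform T) 5 4 := by
  rcases ATAM.TileSystem.isEastward_or_isEastward_mirror hΓ with h | h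
  · exact ATAM.TileSystem.exists_robustlySimulates_of_isEastward hΓ h
  · obtain ⟨T', G', _, Γs, hcard, hsim⟩ :=
      ATAM.TileSystem.exists_robustlySimulates_of_isEastward hΓ.mirror h
    exact ⟨T', G', _, Γs.mirror, hcard, hsim.mirror⟩
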